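/- Let $\varepsilon,\eta\in\mathbb{R}$ be irrational, $\varepsilon\neq\eta$, and let $\Omega\subset\mathbb{R}$ be a bounded interval with more than one point (open, closed or half-open), of length $|\Omega|>0$. Put $$\Sigma_{\varepsilon,\eta}(\Omega)=\{a+b\eta : a,b\in\mathbb{Z},\ a+b\varepsilon\in\Omega\}.$$ This is a Delone set (uniformly discrete and relatively dense in $\mathbb{R}$). It can be written as $\{x_n:n\in\mathbb{Z}\}$ with $(x_n)$ strictly increasing and $x_{-1}<0\le x_0$, and the distances $x_{n+1}-x_n$ take only finitely many values. Let $\boldsymbol{u}_{\varepsilon,\eta}(\Omega)$ be the bi-infinite word over the finite alphabet of these distances whose $n$-th letter is $x_{n+1}-x_n$. Two Delone sets $\Lambda,\Lambda'\subset\mathbb{R}$ are called bounded distance equivalent if there are a constant $C>0$ and a bijection $g:\Lambda\to\Lambda'$ with $|x-g(x)|<C$ for all $x\in\Lambda$. A bi-infinite word is called balanced if there is a constant $c>0$ such that for any two of its factors $w,v$ of the same length and any letter $a$, the numbers $|w|_a,|v|_a$ of occurrences of $a$ in $w$ and $v$ satisfy $|w|_a-|v|_a\le c$. The following three statements are equivalent: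 (a) $\Sigma_{\varepsilon,\eta}(\Omega)$ is bounded distance equivalent to a lattice in $\mathbb{R}$; (b) the word $\boldsymbol{u}_{\varepsilon,\eta}(\Omega)$ is balanced; (c) $|\Omega|\in\mathbb{Z}+\mathbb{Z}\varepsilon$. Moreover, if they hold, then $\Sigma_{\varepsilon,\eta}(\Omega)$ is bounded distance equivalent to the lattice $\frac{|\eta-\varepsilon|}{|\Omega|}\mathbb{Z}$. -/

import Mathlib

open MeasureTheory

noncomputable section

namespace CutProject

/-! ### Delone sets and bounded distance equivalence -/

/-- `Λ` is a Delone set: uniformly discrete and relatively dense. -/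
def IsDelone {E : Type*} [MetricSpace E] (Λ : Set E) : Prop :=
  ∃ D : Delone.DeloneSet E, (D : Set E) = Λ

/-- Bounded distance equivalence of two Delone sets: a bijection between them that moves every
point by less than some constant. -/
def BoundedDistEquiv {E : Type*} [MetricSpace E] (Λ Λ' : Set E) : Prop :=
  IsDelone Λ ∧ IsDelone Λ' ∧
    ∃ C : ℝ, 0 < C ∧ ∃ g : Λ ≃ Λ', ∀ x : Λ, dist (x : E) (g x : E) < C

/-- `Λ` is bounded distance equivalent to a lattice (a discrete subgroup spanning the space). -/
def IsBDL {E : Type*} [NormedAddCommGroup E] [NormedSpace ℝ E] (Λ : Set E) : Prop :=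
  ∃ (L : Submodule ℤ E) (_ : DiscreteTopology L), IsZLattice ℝ L ∧
    BoundedDistEquiv Λ (L : Set E)

/-! ### Bi-infinite words and balancedness -/

/-- The finite word `u_i u_{i+1} ⋯ u_{i+n-1}`. -/
def factorAt {A : Type*} (u : ℤ → A) (i : ℤ) (n : ℕ) : List A :=
  List.ofFn fun k : Fin n => u (i + (k : ℕ))

/-- `w` is a factor of the bi-infinite word `u`. -/
def IsFactor {A : Type*} (w : List A) (u : ℤ → A) : Prop :=
  ∃ (i : ℤ) (n : ℕ), w = factorAt u i n

open Classical in
/-- A bi-infinite word is balanced if the numbers of occurrences of any letter in any two factors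
of equal length differ by at most a fixed constant. -/
def IsBalanced {A : Type*} (u : ℤ → A) : Prop :=
  ∃ c : ℝ, 0 < c ∧ ∀ w v : List A, IsFactor w u → IsFactor v u → w.length = v.length →
    ∀ a : A, (w.count a : ℝ) - (v.count a : ℝ) ≤ c

/-! ### Coding a discrete subset of the line by its gaps -/

/-- `x` lists `Λ` in strictly increasing order, with `x_{-1} < 0 ≤ x_0`. -/
def IsIncreasingEnumeration (x : ℤ → ℝ) (Λ : Set ℝ) : Prop :=
  StrictMono x ∧ Set.range x = Λ ∧ x (-1) < 0 ∧ 0 ≤ x 0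

open Classical in
/-- The (unique) increasing enumeration of `Λ` with `x_{-1} < 0 ≤ x_0`, if there is one; the value
`0` is a default for sets that have none. -/
def enumeration (Λ : Set ℝ) : ℤ → ℝ :=
  if h : ∃ x : ℤ → ℝ, IsIncreasingEnumeration x Λ then h.choose else 0

/-- The word coding the order of the distances between consecutive points of `Λ`; the letters
are the distances themselves. -/
def gapWord (Λ : Set ℝ) : ℤ → ℝ :=
  fun n => enumeration Λ (n + 1) - enumeration Λ n

/-! ### Cut-and-project sets -/

/-- The additive group `ℤ + ℤε`. -/
def ZAdd (ε : ℝ) : Set ℝ :=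
  {x | ∃ a b : ℤ, x = a + b * ε}

/-- The cut-and-project set `{x ∈ ℤ + ℤη : x⋆ ∈ Ω}`, where `(a + bη)⋆ = a + bε`. -/
def cutProject (ε η : ℝ) (Ω : Set ℝ) : Set ℝ :=
  {x | ∃ a b : ℤ, x = a + b * η ∧ (a : ℝ) + b * ε ∈ Ω}

/-- The coding word of the cut-and-project set. -/
def cutProjectWord (ε η : ℝ) (Ω : Set ℝ) : ℤ → ℝ :=
  gapWord (cutProject ε η Ω)

end CutProject

end

/-!
Write `δ = η - ε`. A point `x = a + bη` of the cut-and-project set satisfies `x = x⋆ + bδ` with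
`x⋆ = a + bε` in the bounded window `Ω`. Hence, up to bounded errors, counting the points in an
interval of length `nδ` amounts to counting the pairs `(a, b)` with `a + bε ∈ Ω` and `b` in a block
of `n` consecutive integers, a Birkhoff sum of the rotation by `ε`. All three statements are thereby
compared with one: the number of points in `[u, v)` is `κ (v - u) + O(1)` for some `κ`
(`HasUniformDensity`), equivalently `Ω` is a bounded remainder set for the rotation
(`HasBoundedRemainder`).

* If the length of `Ω` lies in `ℤ + ℤε`, the discrepancy is a difference of two shifts of a bounded
  sequence, so it is bounded (`hasBoundedRemainder_of_mem_ZAdd`). The increasing enumeration then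
  stays close to an arithmetic progression, which gives the bounded distance equivalence with
  `(δ / |Ω|) ℤ`.
* Conversely, if the discrepancy is bounded, it is a coboundary `g(x) - g(x + ε)` with `g` bounded
  and measurable, and `exp (2πi g)` is an eigenfunction of the rotation with eigenvalue
  `exp (2πi κ)`. Fourier coefficients show that `κ ∈ ℤ + ℤε`, and integration over the circle shows
  that `κ = |Ω|` (`HasBoundedRemainder.eq_length`).
* Uniform density passes through bounded distance equivalences and holds for lattices
  (`IsBDL.exists_hasUniformDensity`). If the coding word is balanced, the enumeration is
  quasi-additive, hence close to an arithmetic progression (`IsBalanced.exists_hasUniformDensity`).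
* For the balancedness of the coding word, the points followed by a given gap `d` are those `x` with
  `x + d` in the set and none of finitely many `x + e` in the set. These sets are Boolean
  combinations of cut-and-project sets whose windows are intervals with endpoints in one coset of
  `ℤ + ℤε`. Such windows are closed under intersection and have bounded remainder, so
  inclusion-exclusion (`hasFrequency_diff_biUnion`) gives every letter a frequency with bounded
  error.

The case `η < ε` follows from `ε < η`, as `(-ε, -η)` defines the same set as `(ε, η)`.
-/

namespace CutProject

/-! ### Eigenfunctions of a rotation -/

lemma fourierCoeff_add_right (H : AddCircle (1 : ℝ) → ℂ) (t₀ : AddCircle (1 : ℝ)) (k : ℤ) :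
    fourierCoeff (fun t => H (t + t₀)) k = fourier k t₀ * fourierCoeff H k := by
  have key : ∀ t, fourier (-k) t • H (t + t₀)
      = (fun t => fourier k t₀ * (fourier (-k) t • H t)) (t + t₀) := by
    intro t
    have h1 : (fourier (-k) (t + t₀) : ℂ) = fourier (-k) t * fourier (-k) t₀ := by
      simp only [fourier_apply, smul_add, AddCircle.toCircle_add, Circle.coe_mul]
    have h2 : (fourier k t₀ : ℂ) * fourier (-k) t₀ = 1 := by
      rw [← fourier_add]; simp
    simp only [smul_eq_mul]
    rw [h1]
    linear_combination (-(fourier (-k) t * H (t + t₀))) * h2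
  unfold fourierCoeff
  rw [funext key, integral_add_right_eq_self (fun t => fourier k t₀ * (fourier (-k) t • H t)),
    integral_const_mul]

lemma exists_fourierCoeff_ne_zero (H : AddCircle (1 : ℝ) → ℂ) (hm : Measurable H)
    (h1 : ∀ t, ‖H t‖ = 1) : ∃ k, fourierCoeff H k ≠ 0 := by
  by_contra! h0
  have hL : MemLp H 2 AddCircle.haarAddCircle :=
    MemLp.of_bound hm.aestronglyMeasurable 1 (Filter.Eventually.of_forall fun t => (h1 t).le)
  have h2 := tsum_sq_fourierCoeff hL.toLp
  have h3 : ∀ k, fourierCoeff (hL.toLp H) k = 0 := fun k => by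
    rw [fourierCoeff_congr_ae hL.coeFn_toLp]; exact h0 k
  have h4 : ∫ t : AddCircle (1 : ℝ), ‖hL.toLp H t‖ ^ 2 ∂AddCircle.haarAddCircle = 1 := by
    rw [integral_congr_ae (g := fun _ => (1 : ℝ))]
    · simp
    · filter_upwards [hL.coeFn_toLp] with t ht
      rw [ht, h1]; simp
  rw [h4] at h2
  simp [h3] at h2

/-- The eigenvalues of the rotation by `ε` are the numbers `exp (2πikε)` with `k` an integer. -/
lemma mem_ZAdd_of_eigenfunction {ε κ : ℝ} {H : AddCircle (1 : ℝ) → ℂ} (hm : Measurable H)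
    (h1 : ∀ t, ‖H t‖ = 1)
    (hH : ∀ t, H (t + (ε : AddCircle (1 : ℝ))) = Complex.exp (2 * Real.pi * Complex.I * κ) * H t) :
    κ ∈ ZAdd ε := by
  obtain ⟨k, hk⟩ := exists_fourierCoeff_ne_zero H hm h1
  have h2 := fourierCoeff_add_right H (ε : AddCircle (1 : ℝ)) k
  simp_rw [hH] at h2
  rw [fourierCoeff.const_mul] at h2
  have h3 := mul_right_cancel₀ hk h2
  rw [fourier_coe_apply, Complex.exp_eq_exp_iff_exists_int] at h3
  obtain ⟨n, hn⟩ := h3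
  refine ⟨n, k, ?_⟩
  have h4 : (κ : ℂ) = n + k * ε := by
    have hpi : (2 * Real.pi * Complex.I : ℂ) ≠ 0 := Complex.two_pi_I_ne_zero
    apply mul_left_cancel₀ hpi
    rw [hn]; push_cast; ring
  exact_mod_cast h4

/-! ### Birkhoff sums with bounded discrepancy -/

/-- The excess over `κ` of the number of integers `a` with `a + x ∈ [s, t)`; that number is
`⌈t - x⌉ - ⌈s - x⌉` when `s ≤ t`. -/
noncomputable def excess (s t κ x : ℝ) : ℝ :=
  ⌈t - x⌉ - ⌈s - x⌉ - κ

/-- The Birkhoff sum of `excess` along the rotation by `ε`. -/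
noncomputable def excessSum (ε s t κ : ℝ) (n : ℕ) (x : ℝ) : ℝ :=
  ∑ k ∈ Finset.range n, excess s t κ (x + k * ε)

lemma excess_add_int (s t κ x : ℝ) (a : ℤ) : excess s t κ (x + a) = excess s t κ x := by
  unfold excess
  rw [← sub_sub, ← sub_sub, Int.ceil_sub_intCast, Int.ceil_sub_intCast]
  push_cast; ring

/-- The excess is a difference of two translates of a sawtooth function. -/
lemma excess_eq_fract (s t κ x : ℝ) :
    excess s t κ x = t - s - κ + (Int.fract (x - t) - Int.fract (x - s)) := by
  unfold excess Int.fract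
  rw [← neg_sub x t, ← neg_sub x s, Int.ceil_neg, Int.ceil_neg]
  push_cast; ring

lemma measurable_excess (s t κ : ℝ) : Measurable (excess s t κ) := by
  have : excess s t κ = fun x => t - s - κ + (Int.fract (x - t) - Int.fract (x - s)) :=
    funext (excess_eq_fract s t κ)
  rw [this]
  fun_prop

lemma excessSum_add_int (ε s t κ x : ℝ) (n : ℕ) (a : ℤ) :
    excessSum ε s t κ n (x + a) = excessSum ε s t κ n x := by
  unfold excessSum
  refine Finset.sum_congr rfl fun k _ => ?_
  rw [add_right_comm, excess_add_int]

lemma measurable_excessSum (ε s t κ : ℝ) (n : ℕ) : Measurable (excessSum ε s t κ n) := by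
  unfold excessSum
  exact Finset.measurable_fun_sum _ fun k _ =>
    (measurable_excess s t κ).comp (measurable_id.add_const _)

lemma excessSum_succ (ε s t κ x : ℝ) (n : ℕ) :
    excessSum ε s t κ (n + 1) x = excess s t κ x + excessSum ε s t κ n (x + ε) := by
  unfold excessSum
  rw [Finset.sum_range_succ', add_comm]
  congr 1
  · simp
  · refine Finset.sum_congr rfl fun k _ => ?_
    congr 1; push_cast; ring

lemma dense_ZAdd {ε : ℝ} (hε : Irrational ε) : Dense (ZAdd ε) := by
  have h := dense_addSubgroupClosure_pair_iff (a := ε) (b := 1)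
  rw [div_one] at h
  refine (h.2 hε).mono ?_
  intro z hz
  obtain ⟨m, n, rfl⟩ := AddSubgroup.mem_closure_pair.1 hz
  exact ⟨n, m, by simp [add_comm]⟩

open Filter Topology in
/-- `y ↦ ⌈t - y⌉` is locally constant to the right of every point. -/
lemma eventually_ceil_sub_eq (t x : ℝ) : ∀ᶠ y in 𝓝[>] x, ⌈t - y⌉ = ⌈t - x⌉ := by
  have h : x < t - (⌈t - x⌉ - 1) := by linarith [Int.ceil_lt_add_one (t - x)]
  filter_upwards [Ioo_mem_nhdsGT h] with y hy
  rw [Int.ceil_eq_iff]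
  have := Int.le_ceil (t - x)
  constructor <;> linarith [hy.1, hy.2]

open Filter Topology in
lemma eventually_excessSum_eq (ε s t κ x : ℝ) (n : ℕ) :
    ∀ᶠ y in 𝓝[>] x, excessSum ε s t κ n y = excessSum ε s t κ n x := by
  have h : ∀ k ∈ Finset.range n, ∀ᶠ y in 𝓝[>] x,
      excess s t κ (y + k * ε) = excess s t κ (x + k * ε) := by
    intro k _
    filter_upwards [eventually_ceil_sub_eq (t - k * ε) x, eventually_ceil_sub_eq (s - k * ε) x]
      with y h1 h2
    unfold excess
    rw [show t - (y + k * ε) = t - k * ε - y by ring, show s - (y + k * ε) = s - k * ε - y by ring,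
      show t - (x + k * ε) = t - k * ε - x by ring, show s - (x + k * ε) = s - k * ε - x by ring,
      h1, h2]
  filter_upwards [(Filter.eventually_all_finset _).2 h] with y hy
  exact Finset.sum_congr rfl hy

open Filter Topology in
/-- Birkhoff sums that are bounded on one orbit are bounded everywhere, since they are
right-continuous step functions and the orbit is dense. -/
lemma abs_excessSum_le {ε s t κ C : ℝ} (hε : Irrational ε)
    (hC : ∀ (b : ℤ) (n : ℕ), |excessSum ε s t κ n (b * ε)| ≤ C) (n : ℕ) (x : ℝ) :
    |excessSum ε s t κ n x| ≤ C := by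
  obtain ⟨u, hu, hu'⟩ := mem_nhdsGT_iff_exists_Ioo_subset.1 (eventually_excessSum_eq ε s t κ x n)
  obtain ⟨y, ⟨a, b, rfl⟩, hy⟩ := (dense_ZAdd hε).exists_between hu
  have h : excessSum ε s t κ n (a + b * ε) = excessSum ε s t κ n x := hu' hy
  rw [← h, add_comm, excessSum_add_int]
  exact hC b n

lemma integral_excess_add (s t κ c : ℝ) :
    ∫ x in (0 : ℝ)..1, excess s t κ (x + c) = t - s - κ := by
  have hint : ∀ a : ℝ, IntervalIntegrable (fun x => Int.fract (x + a)) volume 0 1 := by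
    intro a
    refine (intervalIntegrable_const (c := (1 : ℝ))).mono_fun' ?_ ?_
    · exact (measurable_fract.comp (measurable_id.add_const a)).aestronglyMeasurable
    · refine Filter.Eventually.of_forall fun x => ?_
      simp only [Real.norm_eq_abs, Int.abs_fract]
      exact (Int.fract_lt_one _).le
  have hper : ∀ a : ℝ, ∫ x in (0 : ℝ)..1, Int.fract (x + a) = ∫ x in (0 : ℝ)..1, Int.fract x := by
    intro a
    have hp : Function.Periodic (Int.fract : ℝ → ℝ) 1 := fun x => by simp
    rw [intervalIntegral.integral_comp_add_right (fun x => Int.fract x) a]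
    have := hp.intervalIntegral_add_eq a 0
    rw [zero_add] at this ⊢
    rw [add_comm 1 a, this]
  have h : ∀ x, excess s t κ (x + c)
      = t - s - κ + (Int.fract (x + (c - t)) - Int.fract (x + (c - s))) := by
    intro x; rw [excess_eq_fract]; congr 3 <;> ring
  simp_rw [h]
  rw [intervalIntegral.integral_add intervalIntegrable_const ((hint _).sub (hint _)),
    intervalIntegral.integral_sub (hint _) (hint _), hper, hper]
  simp

lemma integral_excessSum (ε s t κ : ℝ) (n : ℕ) :
    ∫ x in (0 : ℝ)..1, excessSum ε s t κ n x = n * (t - s - κ) := by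
  unfold excessSum
  rw [intervalIntegral.integral_finsetSum]
  · simp_rw [integral_excess_add]
    simp only [Finset.sum_const, Finset.card_range, nsmul_eq_mul]
  · intro k _
    refine (intervalIntegrable_const (c := |t - s - κ| + 2)).mono_fun' ?_ ?_
    · exact ((measurable_excess s t κ).comp (measurable_id.add_const _)).aestronglyMeasurable
    · refine Filter.Eventually.of_forall fun x => ?_
      dsimp only
      rw [excess_eq_fract, Real.norm_eq_abs]
      refine (abs_add_le _ _).trans (add_le_add le_rfl ?_)
      rw [abs_le]
      constructor <;> linarith [Int.fract_nonneg (x + k * ε - t), Int.fract_nonneg (x + k * ε - s),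
        Int.fract_lt_one (x + k * ε - t), Int.fract_lt_one (x + k * ε - s)]

/-- The average of the counts over the circle is the length of the window. -/
lemma eq_of_abs_excessSum_le {ε s t κ C : ℝ}
    (hC : ∀ (n : ℕ) (x : ℝ), |excessSum ε s t κ n x| ≤ C) : κ = t - s := by
  by_contra hne
  have hpos : 0 < |t - s - κ| := abs_pos.2 fun h => hne (by linarith)
  obtain ⟨n, hn⟩ := exists_nat_gt (C / |t - s - κ|)
  rw [div_lt_iff₀ hpos] at hn
  have h := intervalIntegral.norm_integral_le_of_norm_le_const (a := 0) (b := 1)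
    (f := excessSum ε s t κ n) (C := C) (fun x _ => hC n x)
  rw [integral_excessSum, Real.norm_eq_abs, abs_mul, Nat.abs_cast] at h
  simp at h
  linarith

open Filter in
/-- A bounded cocycle of the rotation by `ε` is a coboundary, with transfer function the upper
limit of its Birkhoff sums. -/
lemma limsup_excessSum {ε s t κ C : ℝ}
    (hC : ∀ (n : ℕ) (x : ℝ), |excessSum ε s t κ n x| ≤ C) (x : ℝ) :
    limsup (fun n => excessSum ε s t κ n x) atTop
      = excess s t κ x + limsup (fun n => excessSum ε s t κ n (x + ε)) atTop := by
  rw [← limsup_nat_add _ 1, ← limsup_const_add]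
  · simp_rw [excessSum_succ]
  · exact isBoundedUnder_of ⟨C, fun n => (abs_le.1 (hC n _)).2⟩
  · exact (isBoundedUnder_of (r := (· ≥ ·)) ⟨-C, fun n => (abs_le.1 (hC n _)).1⟩).isCoboundedUnder_le

open Filter in
/-- Kesten's theorem, in the direction from bounded discrepancy to the length of the window. If
the counts have bounded deviation from `κ` per step, the exponential of the transfer function is an
eigenfunction of the rotation by `ε`, with eigenvalue `exp (2πiκ)`. -/
theorem mem_ZAdd_of_abs_excessSum_le {ε s t κ C : ℝ}
    (hC : ∀ (n : ℕ) (x : ℝ), |excessSum ε s t κ n x| ≤ C) : κ ∈ ZAdd ε := by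
  set g : ℝ → ℝ := fun x => limsup (fun n => excessSum ε s t κ n x) atTop with hg
  have hgm : Measurable g := Measurable.limsup fun n => measurable_excessSum ε s t κ n
  have hgper : ∀ (x : ℝ) (a : ℤ), g (x + a) = g x := fun x a => by
    simp only [hg, excessSum_add_int]
  set H : AddCircle (1 : ℝ) → ℂ := fun t =>
    Complex.exp (2 * Real.pi * Complex.I * g (AddCircle.measurableEquivIco 1 0 t : ℝ)) with hH
  have hHx : ∀ x : ℝ, H (x : AddCircle (1 : ℝ)) = Complex.exp (2 * Real.pi * Complex.I * g x) := by
    intro x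
    have hx : ((AddCircle.measurableEquivIco 1 0 (x : AddCircle (1 : ℝ)) : ℝ) : AddCircle (1 : ℝ))
        = x := (AddCircle.measurableEquivIco 1 0).symm_apply_apply (x : AddCircle (1 : ℝ))
    rw [← sub_eq_zero, ← AddCircle.coe_sub, AddCircle.coe_eq_zero_iff] at hx
    obtain ⟨n, hn⟩ := hx
    have hy : (AddCircle.measurableEquivIco 1 0 (x : AddCircle (1 : ℝ)) : ℝ) = x + n := by
      simp only [zsmul_eq_mul, mul_one] at hn
      linarith
    simp only [hH]
    rw [hy, hgper]
  refine mem_ZAdd_of_eigenfunction (H := H) ?_ ?_ ?_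
  · have h1 : Measurable fun t : AddCircle (1 : ℝ) => g (AddCircle.measurableEquivIco 1 0 t : ℝ) :=
      hgm.comp (measurable_subtype_coe.comp (AddCircle.measurableEquivIco 1 0).measurable)
    fun_prop
  · intro t
    change ‖Complex.exp _‖ = 1
    rw [show (2 * Real.pi * Complex.I * g (AddCircle.measurableEquivIco 1 0 t : ℝ) : ℂ)
      = ((2 * Real.pi * g (AddCircle.measurableEquivIco 1 0 t : ℝ) : ℝ) : ℂ) * Complex.I by
        push_cast; ring, Complex.norm_exp_ofReal_mul_I]
  · intro y
    induction y using QuotientAddGroup.induction_on with | _ x => ?_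
    have h := limsup_excessSum hC x
    change g x = _ + g (x + ε) at h
    have h2 : ((x : AddCircle (1 : ℝ)) + (ε : AddCircle (1 : ℝ))) = ((x + ε : ℝ) : AddCircle (1 : ℝ)) :=
      rfl
    erw [h2]
    rw [hHx, hHx, ← Complex.exp_add, Complex.exp_eq_exp_iff_exists_int]
    refine ⟨⌈s - x⌉ - ⌈t - x⌉, ?_⟩
    rw [h]
    unfold excess
    push_cast; ring

/-! ### Bounded remainder windows -/

/-- The pairs `(a, b)` with `m ≤ b < m + n` for which `a + bε` lies in the window `A`. -/
def windowPairs (ε : ℝ) (A : Set ℝ) (m : ℤ) (n : ℕ) : Set (ℤ × ℤ) :=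
  {p | m ≤ p.2 ∧ p.2 < m + n ∧ (p.1 : ℝ) + p.2 * ε ∈ A}

/-- The number of points `a + bε` in the window `A` with `m ≤ b < m + n` is `κn` up to a bounded
error: the window `A` is a bounded remainder set for the rotation by `ε`. -/
def HasBoundedRemainder (ε : ℝ) (A : Set ℝ) (κ : ℝ) : Prop :=
  ∃ C : ℝ, ∀ (m : ℤ) (n : ℕ), |((windowPairs ε A m n).ncard : ℝ) - κ * n| ≤ C

lemma windowPairs_mono {ε : ℝ} {A B : Set ℝ} (h : A ⊆ B) (m : ℤ) (n : ℕ) :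
    windowPairs ε A m n ⊆ windowPairs ε B m n :=
  fun _ hp => ⟨hp.1, hp.2.1, h hp.2.2⟩

lemma windowPairs_Ico (ε s t : ℝ) (m : ℤ) (n : ℕ) :
    windowPairs ε (Set.Ico s t) m n
      = (fun p : (_ : ℕ) × ℤ => (p.2, m + (p.1 : ℤ))) '' ((Finset.range n).sigma fun k =>
          Finset.Ico ⌈s - (m * ε + k * ε)⌉ ⌈t - (m * ε + k * ε)⌉ : Finset ((_ : ℕ) × ℤ)) := by
  ext ⟨a, b⟩
  simp only [windowPairs, Set.mem_ofPred_eq, Set.mem_image, Finset.mem_coe, Finset.mem_sigma,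
    Finset.mem_range, Finset.mem_Ico, Int.ceil_le, Int.lt_ceil, Prod.mk.injEq, Set.mem_Ico]
  constructor
  · rintro ⟨h1, h2, h3, h4⟩
    have hk : ((b - m).toNat : ℤ) = b - m := Int.toNat_of_nonneg (by omega)
    have hk' : ((b - m).toNat : ℝ) = b - m := by exact_mod_cast hk
    refine ⟨⟨(b - m).toNat, a⟩, ⟨by dsimp only; omega, ?_, ?_⟩, rfl, by dsimp only; omega⟩
    · rw [hk']; linarith
    · rw [hk']; linarith
  · rintro ⟨⟨k, a⟩, ⟨h1, h2, h3⟩, rfl, rfl⟩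
    dsimp only at *
    refine ⟨by omega, by omega, ?_, ?_⟩ <;> push_cast <;> linarith

lemma ncard_windowPairs_Ico {ε s t : ℝ} (hst : s ≤ t) (κ : ℝ) (m : ℤ) (n : ℕ) :
    ((windowPairs ε (Set.Ico s t) m n).ncard : ℝ) - κ * n = excessSum ε s t κ n (m * ε) := by
  rw [windowPairs_Ico, Set.ncard_image_of_injective, Set.ncard_coe_finset, Finset.card_sigma]
  · unfold excessSum excess
    rw [Finset.sum_sub_distrib, Finset.sum_const, Finset.card_range, nsmul_eq_mul, mul_comm κ]
    push_cast
    congr 1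
    refine Finset.sum_congr rfl fun k _ => ?_
    rw [Int.card_Ico]
    have : ⌈s - (m * ε + k * ε)⌉ ≤ ⌈t - (m * ε + k * ε)⌉ := Int.ceil_mono (by linarith)
    rw [← Int.cast_natCast, Int.toNat_of_nonneg (by linarith)]
    push_cast; rfl
  · rintro ⟨k, a⟩ ⟨l, b⟩ h
    simp only [Prod.mk.injEq, add_right_inj, Nat.cast_inj] at h
    obtain ⟨rfl, rfl⟩ := h
    rfl

lemma finite_windowPairs {ε s t : ℝ} {A : Set ℝ} (hA : A ⊆ Set.Icc s t) (m : ℤ) (n : ℕ) :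
    (windowPairs ε A m n).Finite := by
  refine Set.Finite.subset (s := windowPairs ε (Set.Ico s (t + 1)) m n) ?_ ?_
  · rw [windowPairs_Ico]
    exact (Finset.finite_toSet _).image _
  · exact windowPairs_mono (hA.trans (Set.Icc_subset_Ico_right (by linarith))) m n

/-- `(a, b) ↦ a + bθ` is injective for irrational `θ`. -/
lemma int_add_mul_injective {θ : ℝ} (hθ : Irrational θ) :
    Function.Injective fun p : ℤ × ℤ => (p.1 : ℝ) + p.2 * θ := by
  rintro ⟨a, b⟩ ⟨c, d⟩ h
  dsimp only at h
  have hbd : b = d := by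
    by_contra hne
    have hne' : (b : ℝ) - d ≠ 0 := sub_ne_zero.2 (by exact_mod_cast hne)
    apply hθ
    refine ⟨((c - a : ℤ) : ℚ) / ((b - d : ℤ) : ℚ), ?_⟩
    push_cast
    rw [div_eq_iff hne']; linarith
  subst hbd
  have : (a : ℝ) = c := by linarith
  rw [Int.cast_inj.1 this]

lemma ncard_fiber_le_one {ε : ℝ} (hε : Irrational ε) (y : ℝ) :
    {p : ℤ × ℤ | (p.1 : ℝ) + p.2 * ε = y}.ncard ≤ 1 := by
  have hs : {p : ℤ × ℤ | (p.1 : ℝ) + p.2 * ε = y}.Subsingleton :=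
    fun p hp q hq => int_add_mul_injective hε (hp.trans hq.symm)
  exact (Set.ncard_le_one hs.finite).2 fun p hp q hq => hs hp hq

lemma finite_fiber {ε : ℝ} (hε : Irrational ε) (y : ℝ) :
    {p : ℤ × ℤ | (p.1 : ℝ) + p.2 * ε = y}.Finite :=
  Set.Subsingleton.finite fun _ hp _ hq => int_add_mul_injective hε (hp.trans hq.symm)

/-- Changing the endpoints of a window changes the counts by at most one. -/
lemma abs_ncard_windowPairs_sub_le {ε s t : ℝ} (hε : Irrational ε) {A : Set ℝ}
    (h1 : Set.Ioo s t ⊆ A) (h2 : A ⊆ Set.Icc s t) (m : ℤ) (n : ℕ) :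
    |((windowPairs ε A m n).ncard : ℝ) - (windowPairs ε (Set.Ico s t) m n).ncard| ≤ 1 := by
  have hle : (windowPairs ε A m n).ncard ≤ (windowPairs ε (Set.Ico s t) m n).ncard + 1 := by
    refine (Set.ncard_le_ncard (t := windowPairs ε (Set.Ico s t) m n ∪
      {p : ℤ × ℤ | (p.1 : ℝ) + p.2 * ε = t}) ?_ ?_).trans ((Set.ncard_union_le _ _).trans
        (Nat.add_le_add_left (ncard_fiber_le_one hε t) _))
    · rintro p ⟨hp1, hp2, hp3⟩
      rcases (h2 hp3).2.lt_or_eq with h | h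
      · exact Or.inl ⟨hp1, hp2, (h2 hp3).1, h⟩
      · exact Or.inr h
    · exact (finite_windowPairs Set.Ico_subset_Icc_self m n).union (finite_fiber hε t)
  have hge : (windowPairs ε (Set.Ico s t) m n).ncard ≤ (windowPairs ε A m n).ncard + 1 := by
    refine (Set.ncard_le_ncard (t := windowPairs ε A m n ∪
      {p : ℤ × ℤ | (p.1 : ℝ) + p.2 * ε = s}) ?_ ?_).trans ((Set.ncard_union_le _ _).trans
        (Nat.add_le_add_left (ncard_fiber_le_one hε s) _))
    · rintro p ⟨hp1, hp2, hp3⟩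
      rcases hp3.1.lt_or_eq with h | h
      · exact Or.inl ⟨hp1, hp2, h1 ⟨h, hp3.2⟩⟩
      · exact Or.inr h.symm
    · exact (finite_windowPairs h2 m n).union (finite_fiber hε s)
  have hle' : ((windowPairs ε A m n).ncard : ℝ) ≤ (windowPairs ε (Set.Ico s t) m n).ncard + 1 := by
    exact_mod_cast hle
  have hge' : ((windowPairs ε (Set.Ico s t) m n).ncard : ℝ) ≤ (windowPairs ε A m n).ncard + 1 := by
    exact_mod_cast hge
  rw [abs_le]; constructor <;> linarith

/-- Kesten's theorem: the only possible frequency of an interval that is a bounded remainder set is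
its length, and this lies in `ℤ + ℤε`. -/
theorem HasBoundedRemainder.eq_length {ε s t κ : ℝ} (hε : Irrational ε) {A : Set ℝ} (hst : s ≤ t)
    (h1 : Set.Ioo s t ⊆ A) (h2 : A ⊆ Set.Icc s t) (h : HasBoundedRemainder ε A κ) :
    κ = t - s ∧ t - s ∈ ZAdd ε := by
  obtain ⟨C, hC⟩ := h
  -- The block of layers starting at `b` is the orbit segment of the rotation starting at `bε`.
  have hb : ∀ (b : ℤ) (n : ℕ), |excessSum ε s t κ n (b * ε)| ≤ C + 1 := by
    intro b n
    rw [← ncard_windowPairs_Ico hst]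
    have h3 := abs_le.1 (hC b n)
    have h4 := abs_le.1 (abs_ncard_windowPairs_sub_le hε h1 h2 b n)
    rw [abs_le]; constructor <;> linarith
  have hb' := fun n x => abs_excessSum_le hε hb n x
  have hκ := eq_of_abs_excessSum_le hb'
  exact ⟨hκ, hκ ▸ mem_ZAdd_of_abs_excessSum_le hb'⟩

lemma abs_sum_shift_sub_le {r : ℤ → ℝ} (hr : ∀ j, |r j| ≤ 1) (q : ℕ) (b : ℤ) (n : ℕ) :
    |∑ k ∈ Finset.range n, (r (b + k + q) - r (b + k))| ≤ 2 * q := by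
  induction q with
  | zero => simp
  | succ q ih =>
    have htel : ∑ k ∈ Finset.range n, (r (b + k + (q + 1 : ℕ)) - r (b + k + q))
        = r (b + n + q) - r (b + q) := by
      have h := Finset.sum_range_sub (fun k : ℕ => r (b + k + q)) n
      rw [Nat.cast_zero, add_zero] at h
      rw [← h]
      refine Finset.sum_congr rfl fun k _ => ?_
      congr 2; push_cast; ring
    have hsplit : ∑ k ∈ Finset.range n, (r (b + k + (q + 1 : ℕ)) - r (b + k))
        = ∑ k ∈ Finset.range n, (r (b + k + (q + 1 : ℕ)) - r (b + k + q))
          + ∑ k ∈ Finset.range n, (r (b + k + q) - r (b + k)) := by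
      rw [← Finset.sum_add_distrib]
      exact Finset.sum_congr rfl fun k _ => by ring
    rw [hsplit, htel]
    have h1 := abs_le.1 (hr (b + n + q))
    have h2 := abs_le.1 (hr (b + q))
    have h3 := abs_le.1 ih
    rw [abs_le]; push_cast; constructor <;> linarith

lemma abs_sum_shift_int_sub_le {r : ℤ → ℝ} (hr : ∀ j, |r j| ≤ 1) (q : ℤ) (b : ℤ) (n : ℕ) :
    |∑ k ∈ Finset.range n, (r (b + k + q) - r (b + k))| ≤ 2 * |(q : ℝ)| := by
  obtain ⟨p, rfl | rfl⟩ := q.eq_nat_or_neg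
  · simpa using abs_sum_shift_sub_le hr p b n
  · have h := abs_sum_shift_sub_le hr p (b - p) n
    rw [← abs_neg, ← Finset.sum_neg_distrib]
    simp only [Int.cast_neg, abs_neg, Int.cast_natCast, Nat.abs_cast]
    convert h using 3 with k
    rw [neg_sub]
    congr 2 <;> ring

/-- The theorem of Hecke and Ostrowski: an interval with length in `ℤ + ℤε` is a bounded remainder
set, since its discrepancy is a difference of two shifts of a bounded sequence. -/
theorem hasBoundedRemainder_of_mem_ZAdd {ε s t : ℝ} (hε : Irrational ε) {A : Set ℝ} (hst : s ≤ t)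
    (h1 : Set.Ioo s t ⊆ A) (h2 : A ⊆ Set.Icc s t) (h : t - s ∈ ZAdd ε) :
    HasBoundedRemainder ε A (t - s) := by
  obtain ⟨p, q, hpq⟩ := h
  refine ⟨2 * |((-q : ℤ) : ℝ)| + 1, fun m n => ?_⟩
  have h3 := abs_le.1 (abs_ncard_windowPairs_sub_le hε h1 h2 m n)
  have h4 := ncard_windowPairs_Ico (ε := ε) hst (t - s) m n
  have h5 : excessSum ε s t (t - s) n (m * ε) = ∑ k ∈ Finset.range n,
      ((fun j : ℤ => Int.fract (j * ε - s)) (m + k + -q)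
        - (fun j : ℤ => Int.fract (j * ε - s)) (m + k)) := by
    unfold excessSum
    refine Finset.sum_congr rfl fun k _ => ?_
    rw [excess_eq_fract, sub_self, zero_add]
    congr 1
    · have : (m * ε + k * ε - t : ℝ) = ((m + k + -q : ℤ) : ℝ) * ε - s - p := by
        push_cast; linarith
      rw [this, Int.fract_sub_intCast]
    · congr 1; push_cast; ring
  have h6 := abs_sum_shift_int_sub_le (r := fun j : ℤ => Int.fract (j * ε - s))
    (fun j => by rw [Int.abs_fract]; exact (Int.fract_lt_one _).le) (-q) m n
  rw [← h5] at h6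
  have h7 := abs_le.1 h6
  rw [abs_le]; constructor <;> linarith

/-! ### Uniform density -/

/-- The number of points of `Λ` in `[u, v)` is finite and equal to `κ (v - u)` up to a bounded error.
Finiteness is part of the condition because `Set.ncard` is `0` on infinite sets. -/
def HasUniformDensity (Λ : Set ℝ) (κ : ℝ) : Prop :=
  ∃ C : ℝ, ∀ u v : ℝ, u ≤ v →
    (Λ ∩ Set.Ico u v).Finite ∧ |((Λ ∩ Set.Ico u v).ncard : ℝ) - κ * (v - u)| ≤ C

lemma exists_subset_Icc_neg {s t : ℝ} {A : Set ℝ} (hA : A ⊆ Set.Icc s t) :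
    ∃ R, 0 ≤ R ∧ A ⊆ Set.Icc (-R) R := by
  refine ⟨|s| + |t|, by positivity, hA.trans (Set.Icc_subset_Icc ?_ ?_)⟩
  · linarith [neg_abs_le s, abs_nonneg t]
  · linarith [le_abs_self t, abs_nonneg s]

/-- Since `x = x⋆ + b (η - ε)` for `x = a + bη`, the points in `[u, v)` have `b` in a corresponding
range, up to the size of the window. -/
lemma cutProject_inter_Ico_subset {ε η R : ℝ} (hδ : ε < η) {A : Set ℝ}
    (hA : A ⊆ Set.Icc (-R) R) {u v : ℝ} {m : ℤ} {n : ℕ} (hm : m * (η - ε) ≤ u - R)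
    (hn : v + R ≤ (m + n) * (η - ε)) :
    cutProject ε η A ∩ Set.Ico u v
      ⊆ (fun p : ℤ × ℤ => (p.1 : ℝ) + p.2 * η) '' windowPairs ε A m n := by
  rintro _ ⟨⟨a, b, rfl, hab⟩, hu, hv⟩
  have h := hA hab
  have hδ' : 0 < η - ε := sub_pos.2 hδ
  refine ⟨(a, b), ⟨?_, ?_, hab⟩, rfl⟩
  · have : (m : ℝ) * (η - ε) ≤ b * (η - ε) := by linarith [h.2]
    exact_mod_cast le_of_mul_le_mul_right this hδ'
  · have : (b : ℝ) * (η - ε) < (m + n) * (η - ε) := by linarith [h.1]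
    exact_mod_cast lt_of_mul_lt_mul_right this hδ'.le

/-- The converse inclusion to `cutProject_inter_Ico_subset`, for a range of `b` that is shortened by
the size of the window. -/
lemma image_windowPairs_subset {ε η R : ℝ} (hδ : ε < η) {A : Set ℝ}
    (hA : A ⊆ Set.Icc (-R) R) {u v : ℝ} {m : ℤ} {n : ℕ} (hm : u + R ≤ m * (η - ε))
    (hn : (m + n - 1) * (η - ε) < v - R) :
    (fun p : ℤ × ℤ => (p.1 : ℝ) + p.2 * η) '' windowPairs ε A m n
      ⊆ cutProject ε η A ∩ Set.Ico u v := by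
  rintro _ ⟨⟨a, b⟩, ⟨h1, h2, hab⟩, rfl⟩
  dsimp only at h1 h2 hab ⊢
  have h := hA hab
  have hδ' : 0 < η - ε := sub_pos.2 hδ
  refine ⟨⟨a, b, rfl, hab⟩, ?_, ?_⟩
  · have : (m : ℝ) * (η - ε) ≤ b * (η - ε) :=
      mul_le_mul_of_nonneg_right (by exact_mod_cast h1) hδ'.le
    linarith [h.1]
  · have h3 : (b : ℝ) ≤ m + n - 1 := by
      have : b ≤ m + n - 1 := by omega
      exact_mod_cast this
    have : (b : ℝ) * (η - ε) ≤ (m + n - 1) * (η - ε) :=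
      mul_le_mul_of_nonneg_right h3 hδ'.le
    linarith [h.2]

lemma finite_cutProject_inter {ε η s t : ℝ} (hδ : ε < η) {A : Set ℝ} (hA : A ⊆ Set.Icc s t)
    (u v : ℝ) : (cutProject ε η A ∩ Set.Ico u v).Finite := by
  obtain ⟨R, hR, hA'⟩ := exists_subset_Icc_neg hA
  have hδ' : 0 < η - ε := sub_pos.2 hδ
  refine Set.Finite.subset ((finite_windowPairs hA ⌊(u - R) / (η - ε)⌋
    ⌈(v + R) / (η - ε) - ⌊(u - R) / (η - ε)⌋⌉₊).image _)
    (cutProject_inter_Ico_subset hδ hA' ?_ ?_)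
  · rw [← le_div_iff₀ hδ']; exact Int.floor_le _
  · rw [← div_le_iff₀ hδ']
    linarith [Nat.le_ceil ((v + R) / (η - ε) - ⌊(u - R) / (η - ε)⌋)]

/-- A bounded remainder window gives a cut-and-project set of uniform density. -/
lemma HasBoundedRemainder.hasUniformDensity {ε η s t κ : ℝ} (hη : Irrational η) (hδ : ε < η)
    {A : Set ℝ} (hA : A ⊆ Set.Icc s t) (h : HasBoundedRemainder ε A κ) :
    HasUniformDensity (cutProject ε η A) (κ / (η - ε)) := by
  obtain ⟨C, hC⟩ := h
  obtain ⟨R, hR, hA'⟩ := exists_subset_Icc_neg hA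
  have hδ' : 0 < η - ε := sub_pos.2 hδ
  set δ := η - ε with hδdef
  refine ⟨C + |κ| * (2 * R / δ + 3), fun u v huv => ⟨finite_cutProject_inter hδ hA u v, ?_⟩⟩
  have hw : 0 ≤ (v - u) / δ := div_nonneg (by linarith) hδ'.le
  have hRδ : 0 ≤ R / δ := div_nonneg hR hδ'.le
  have hR2 : 2 * R / δ = R / δ + R / δ := by ring
  have huδ : u / δ * δ = u := div_mul_cancel₀ _ hδ'.ne'
  have hvu : (v - u) / δ = v / δ - u / δ := sub_div _ _ _
  have herr : ∀ n : ℕ, |(n : ℝ) - (v - u) / δ| ≤ 2 * R / δ + 3 →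
      |κ * n - κ / δ * (v - u)| ≤ |κ| * (2 * R / δ + 3) := by
    intro n hn
    rw [show κ * n - κ / δ * (v - u) = κ * (n - (v - u) / δ) by ring, abs_mul]
    exact mul_le_mul_of_nonneg_left hn (abs_nonneg _)
  rw [abs_le]
  constructor
  · set m := ⌈(u + R) / δ⌉ with hm
    set n := ⌊(v - u - 2 * R) / δ⌋₊ with hn
    have hn1 : (v - u - 2 * R) / δ - 1 < n := Nat.sub_one_lt_floor _
    have hn2 : (n : ℝ) ≤ (v - u) / δ := by
      by_cases h0 : n = 0
      · rw [h0]; simpa using hw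
      · have := Nat.floor_le (a := (v - u - 2 * R) / δ) (by
          by_contra hneg
          exact h0 (Nat.floor_of_nonpos (not_le.1 hneg).le))
        rw [← hn] at this
        rw [sub_div, hR2] at this
        linarith
    have hsub : (fun p : ℤ × ℤ => (p.1 : ℝ) + p.2 * η) '' windowPairs ε A m n
        ⊆ cutProject ε η A ∩ Set.Ico u v := by
      by_cases h0 : n = 0
      · rintro _ ⟨p, ⟨h1, h2, -⟩, -⟩
        rw [h0] at h2; simp at h2; omega
      · refine image_windowPairs_subset hδ hA' ?_ ?_
        · rw [← div_le_iff₀ hδ']; exact Int.le_ceil _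
        · rw [← lt_div_iff₀ hδ']
          have h1 : (m : ℝ) < (u + R) / δ + 1 := Int.ceil_lt_add_one _
          have h2 := Nat.floor_le (a := (v - u - 2 * R) / δ) (by
            by_contra hneg
            exact h0 (Nat.floor_of_nonpos (not_le.1 hneg).le))
          rw [← hn] at h2
          rw [sub_div, hR2] at h2
          rw [add_div] at h1
          rw [sub_div]
          linarith
    have hcard := Set.ncard_le_ncard hsub (finite_cutProject_inter hδ hA u v)
    rw [Set.ncard_image_of_injective _ (int_add_mul_injective hη)] at hcard
    have hcard' : ((windowPairs ε A m n).ncard : ℝ) ≤ (cutProject ε η A ∩ Set.Ico u v).ncard := by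
      exact_mod_cast hcard
    have h1 := abs_le.1 (hC m n)
    rw [sub_div, hR2] at hn1
    have h2 := abs_le.1 (herr n (by rw [abs_le]; constructor <;> linarith))
    linarith
  · set m := ⌊(u - R) / δ⌋ with hm
    set n := ⌈(v - u + 2 * R) / δ + 1⌉₊ with hn
    have hn0 : 0 ≤ (v - u + 2 * R) / δ + 1 := by rw [add_div, hR2]; linarith
    have hn1 : (v - u + 2 * R) / δ + 1 ≤ n := Nat.le_ceil _
    have hn2 : (n : ℝ) < (v - u + 2 * R) / δ + 1 + 1 := Nat.ceil_lt_add_one hn0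
    rw [add_div, hR2] at hn1 hn2
    have hsub : cutProject ε η A ∩ Set.Ico u v
        ⊆ (fun p : ℤ × ℤ => (p.1 : ℝ) + p.2 * η) '' windowPairs ε A m n := by
      refine cutProject_inter_Ico_subset hδ hA' ?_ ?_
      · rw [← le_div_iff₀ hδ']; exact Int.floor_le _
      · rw [← div_le_iff₀ hδ']
        have h1 : (u - R) / δ - 1 < m := Int.sub_one_lt_floor _
        rw [sub_div] at h1
        rw [add_div]
        linarith
    have hcard := Set.ncard_le_ncard hsub ((finite_windowPairs hA m n).image _)
    rw [Set.ncard_image_of_injective _ (int_add_mul_injective hη)] at hcard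
    have hcard' : ((cutProject ε η A ∩ Set.Ico u v).ncard : ℝ) ≤ (windowPairs ε A m n).ncard := by
      exact_mod_cast hcard
    have h1 := abs_le.1 (hC m n)
    have h2 := abs_le.1 (herr n (by rw [abs_le]; constructor <;> linarith))
    linarith

/-- A cut-and-project set of uniform density has a bounded remainder window. -/
lemma HasUniformDensity.hasBoundedRemainder {ε η s t κ : ℝ} (hη : Irrational η) (hδ : ε < η)
    {A : Set ℝ} (hA : A ⊆ Set.Icc s t) (h : HasUniformDensity (cutProject ε η A) κ) :
    HasBoundedRemainder ε A (κ * (η - ε)) := by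
  obtain ⟨C, hC⟩ := h
  obtain ⟨R, hR, hA'⟩ := exists_subset_Icc_neg hA
  have hδ' : 0 < η - ε := sub_pos.2 hδ
  set δ := η - ε with hδdef
  refine ⟨C + |κ| * (2 * R), fun m n => ?_⟩
  have hnδ : 0 ≤ n * δ := by positivity
  have herr : ∀ w : ℝ, |w - n * δ| ≤ 2 * R → |κ * w - κ * δ * n| ≤ |κ| * (2 * R) := by
    intro w hw
    rw [show κ * w - κ * δ * n = κ * (w - n * δ) by ring, abs_mul]
    exact mul_le_mul_of_nonneg_left hw (abs_nonneg _)
  rw [abs_le]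
  constructor
  · have hsub : cutProject ε η A ∩ Set.Ico (m * δ + R) (max (m * δ + R) ((m + n) * δ - R))
        ⊆ (fun p : ℤ × ℤ => (p.1 : ℝ) + p.2 * η) '' windowPairs ε A m n := by
      rcases le_total ((m + n) * δ - R) (m * δ + R) with hle | hle
      · rw [max_eq_left hle]; simp
      · rw [max_eq_right hle]
        exact cutProject_inter_Ico_subset hδ hA' (by linarith) (by linarith)
    have hcard := Set.ncard_le_ncard hsub ((finite_windowPairs hA m n).image _)
    rw [Set.ncard_image_of_injective _ (int_add_mul_injective hη)] at hcard
    have hcard' : ((cutProject ε η A ∩ Set.Ico (m * δ + R)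
        (max (m * δ + R) ((m + n) * δ - R))).ncard : ℝ) ≤ (windowPairs ε A m n).ncard := by
      exact_mod_cast hcard
    have h1 := abs_le.1 (hC (m * δ + R) (max (m * δ + R) ((m + n) * δ - R)) (le_max_left _ _)).2
    have h2 := abs_le.1 (herr (max (m * δ + R) ((m + n) * δ - R) - (m * δ + R)) (by
      rw [abs_le]
      constructor
      · linarith [le_max_right (m * δ + R) ((m + n) * δ - R)]
      · have : max (m * δ + R) ((m + n) * δ - R) ≤ (m + n) * δ + R :=
          max_le (by linarith) (by linarith)
        linarith))
    linarith
  · have hsub : (fun p : ℤ × ℤ => (p.1 : ℝ) + p.2 * η) '' windowPairs ε A m n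
        ⊆ cutProject ε η A ∩ Set.Ico (m * δ - R) ((m + n) * δ + R) :=
      image_windowPairs_subset hδ hA' (by linarith) (by linarith)
    have hcard := Set.ncard_le_ncard hsub (finite_cutProject_inter hδ hA _ _)
    rw [Set.ncard_image_of_injective _ (int_add_mul_injective hη)] at hcard
    have hcard' : ((windowPairs ε A m n).ncard : ℝ)
        ≤ (cutProject ε η A ∩ Set.Ico (m * δ - R) ((m + n) * δ + R)).ncard := by
      exact_mod_cast hcard
    have h1 := abs_le.1 (hC (m * δ - R) ((m + n) * δ + R) (by linarith)).2
    have h2 := abs_le.1 (herr ((m + n) * δ + R - (m * δ - R)) (by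
      rw [abs_le]; constructor <;> linarith))
    linarith

/-! ### Delone sets on the line and their enumerations -/

lemma isDelone_of_real {Λ : Set ℝ} {r L : ℝ} (hr : 0 < r)
    (hsep : ∀ x ∈ Λ, ∀ y ∈ Λ, x ≠ y → r < |x - y|) (hL : ∀ x, ∃ y ∈ Λ, |x - y| ≤ L) :
    IsDelone Λ := by
  have hL0 : 0 ≤ L := by
    obtain ⟨y, -, hy⟩ := hL 0
    exact (abs_nonneg _).trans hy
  refine ⟨⟨Λ, r.toNNReal, Real.toNNReal_pos.2 hr, ?_, (L + 1).toNNReal,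
    Real.toNNReal_pos.2 (by linarith), ?_⟩, rfl⟩
  · intro x hx y hy hxy
    change ((r.toNNReal : NNReal) : ENNReal) < edist x y
    rw [edist_dist, Real.dist_eq]
    exact (ENNReal.ofReal_lt_ofReal_iff_of_nonneg hr.le).2 (hsep x hx y hy hxy)
  · intro x _
    obtain ⟨y, hy, hxy⟩ := hL x
    refine ⟨y, hy, ?_⟩
    change edist x y ≤ ((L + 1).toNNReal : NNReal)
    rw [edist_dist, Real.dist_eq]
    exact ENNReal.ofReal_le_ofReal (by linarith)

lemma IsDelone.exists_separation {Λ : Set ℝ} (h : IsDelone Λ) :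
    ∃ r > 0, ∀ x ∈ Λ, ∀ y ∈ Λ, x ≠ y → r < |x - y| := by
  obtain ⟨D, rfl⟩ := h
  exact ⟨D.packingRadius, D.packingRadius_pos, fun x hx y hy hxy =>
    D.packingRadius_lt_dist_of_mem_ne hx hy hxy⟩

lemma IsDelone.exists_covering {Λ : Set ℝ} (h : IsDelone Λ) :
    ∃ L, ∀ x, ∃ y ∈ Λ, |x - y| ≤ L := by
  obtain ⟨D, rfl⟩ := h
  exact ⟨D.coveringRadius, fun x => D.exists_dist_le_coveringRadius x⟩

lemma isDelone_zmultiples {τ : ℝ} (hτ : 0 < τ) : IsDelone (AddSubgroup.zmultiples τ : Set ℝ) := by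
  refine isDelone_of_real (r := τ / 2) (L := τ) (by linarith) ?_ ?_
  · rintro _ ⟨m, rfl⟩ _ ⟨n, rfl⟩ hne
    have hmn : m ≠ n := fun h => hne (by rw [h])
    have h1 : (1 : ℝ) ≤ |(m : ℝ) - n| := by
      have : 1 ≤ |m - n| := Int.one_le_abs (sub_ne_zero.2 hmn)
      exact_mod_cast this
    simp only [zsmul_eq_mul]
    rw [← sub_mul, abs_mul, abs_of_pos hτ]
    nlinarith
  · intro x
    refine ⟨(⌊x / τ⌋ : ℤ) • τ, ⟨_, rfl⟩, ?_⟩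
    have h1 := Int.floor_le (x / τ)
    have h2 := Int.lt_floor_add_one (x / τ)
    rw [le_div_iff₀ hτ] at h1
    rw [div_lt_iff₀ hτ] at h2
    rw [zsmul_eq_mul, abs_le]
    constructor <;> linarith

/-- A locally finite subset of the line that is unbounded in both directions has an increasing
enumeration by the integers. -/
lemma exists_isIncreasingEnumeration {Λ : Set ℝ} (hfin : ∀ u v, (Λ ∩ Set.Ico u v).Finite)
    (hup : ∀ x, ∃ y ∈ Λ, x < y) (hdown : ∀ x, ∃ y ∈ Λ, y < x) :
    ∃ x, IsIncreasingEnumeration x Λ := by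
  classical
  let _ : LocallyFiniteOrder Λ := LocallyFiniteOrder.ofFiniteIcc fun a b => by
    refine Set.Finite.of_finite_image (f := ((↑) : Λ → ℝ)) ((hfin a (b + 1)).subset ?_)
      Subtype.val_injective.injOn
    rintro _ ⟨c, hc, rfl⟩
    exact ⟨c.2, hc.1, lt_of_le_of_lt (show (c : ℝ) ≤ b from hc.2) (lt_add_one _)⟩
  have : NoMaxOrder Λ := ⟨fun a => by
    obtain ⟨y, hy, h⟩ := hup a
    exact ⟨⟨y, hy⟩, h⟩⟩
  have : NoMinOrder Λ := ⟨fun a => by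
    obtain ⟨y, hy, h⟩ := hdown a
    exact ⟨⟨y, hy⟩, h⟩⟩
  have : Nonempty Λ := by
    obtain ⟨y, hy, -⟩ := hup 0
    exact ⟨⟨y, hy⟩⟩
  let _ := LinearLocallyFiniteOrder.succOrder Λ
  let _ := LinearLocallyFiniteOrder.predOrder Λ
  let e : ℤ ≃o Λ := orderIsoIntOfLinearSuccPredArch.symm
  have hemono : StrictMono fun n => (e n : ℝ) := fun a b hab => e.strictMono hab
  obtain ⟨y, hy, hy0⟩ := hdown 0
  obtain ⟨z, hz, hz0⟩ := hup 0
  -- `N` is the index of the largest negative point; the enumeration is shifted to start after it.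
  obtain ⟨N, hN, hNmax⟩ := Int.exists_greatest_of_bdd (P := fun n => (e n : ℝ) < 0)
    ⟨e.symm ⟨z, hz⟩, fun n hn => by
      by_contra hlt
      have := hemono.monotone (not_le.1 hlt).le
      simp only [OrderIso.apply_symm_apply] at this
      linarith⟩
    ⟨e.symm ⟨y, hy⟩, by simpa using hy0⟩
  refine ⟨fun n => e (n + (N + 1)), fun a b hab => hemono (by simpa using hab), ?_, ?_, ?_⟩
  · ext w
    constructor
    · rintro ⟨n, rfl⟩
      exact (e _).2
    · intro hw
      exact ⟨e.symm ⟨w, hw⟩ - (N + 1), by simp⟩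
  · simpa using hN
  · by_contra hneg
    have := hNmax _ (not_le.1 hneg)
    omega

lemma enumeration_spec {Λ : Set ℝ} (h : ∃ x, IsIncreasingEnumeration x Λ) :
    IsIncreasingEnumeration (enumeration Λ) Λ := by
  unfold enumeration
  rw [dif_pos h]
  exact h.choose_spec

/-! ### Cut-and-project sets are Delone sets -/

lemma sub_mem_cutProject {ε η R : ℝ} {A : Set ℝ} (hA : A ⊆ Set.Icc (-R) R) {x y : ℝ}
    (hx : x ∈ cutProject ε η A) (hy : y ∈ cutProject ε η A) :
    x - y ∈ cutProject ε η (Set.Icc (-(2 * R)) (2 * R)) := by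
  obtain ⟨a, b, rfl, hab⟩ := hx
  obtain ⟨c, d, rfl, hcd⟩ := hy
  refine ⟨a - c, b - d, by push_cast; ring, ?_⟩
  have h1 := hA hab
  have h2 := hA hcd
  push_cast
  constructor <;> linarith [h1.1, h1.2, h2.1, h2.2]

/-- Cut-and-project sets have finite local complexity: they have finitely many differences of
bounded size. -/
lemma finite_differences {ε η s t : ℝ} (hδ : ε < η) {A : Set ℝ} (hA : A ⊆ Set.Icc s t) (r : ℝ) :
    {z | |z| ≤ r ∧ ∃ x ∈ cutProject ε η A, ∃ y ∈ cutProject ε η A, z = x - y}.Finite := by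
  obtain ⟨R, -, hA'⟩ := exists_subset_Icc_neg hA
  refine (finite_cutProject_inter hδ (subset_refl (Set.Icc (-(2 * R)) (2 * R))) (-r)
    (r + 1)).subset ?_
  rintro _ ⟨hz, x, hx, y, hy, rfl⟩
  have h := abs_le.1 hz
  exact ⟨sub_mem_cutProject hA' hx hy, h.1, by linarith [h.2]⟩

lemma exists_separation_cutProject {ε η s t : ℝ} (hδ : ε < η) {A : Set ℝ}
    (hA : A ⊆ Set.Icc s t) :
    ∃ r > 0, ∀ x ∈ cutProject ε η A, ∀ y ∈ cutProject ε η A, x ≠ y → r < |x - y| := by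
  -- The nonzero differences of size at most `1` form a finite set, which stays away from `0`.
  have hF := (finite_differences hδ hA 1).subset (Set.sdiff_subset (t := {0}))
  have hmem := hF.isClosed.isOpen_compl.mem_nhds (x := (0 : ℝ)) (by simp)
  obtain ⟨r, hr, hball⟩ := Metric.mem_nhds_iff.1 hmem
  refine ⟨min (r / 2) 1, by positivity, fun x hx y hy hxy => ?_⟩
  by_contra! hle
  refine hball (a := x - y) ?_ ⟨⟨hle.trans (min_le_right _ _), x, hx, y, hy, rfl⟩,
    sub_ne_zero.2 hxy⟩
  rw [mem_ball_zero_iff, Real.norm_eq_abs]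
  linarith [min_le_left (r / 2) 1]

/-- Relative density: multiples of a small positive `j + kε` reach the window in a bounded number
of steps. -/
lemma exists_covering_cutProject {ε η s t : ℝ} (hε : Irrational ε) (hδ : ε < η) (hst : s < t)
    {A : Set ℝ} (hA : Set.Ioo s t ⊆ A) :
    ∃ L, ∀ x, ∃ y ∈ cutProject ε η A, |x - y| ≤ L := by
  have hδ' : 0 < η - ε := sub_pos.2 hδ
  obtain ⟨_, ⟨j, k, rfl⟩, hσ0, hσ1⟩ := (dense_ZAdd hε).exists_between (sub_pos.2 hst)
  set σ : ℝ := j + k * ε with hσ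
  refine ⟨|s| + |t| + (η - ε) + (1 / σ + 1) * |(k : ℝ)| * (η - ε), fun x => ?_⟩
  -- The layer `b` lies near `x`; `a` brings `a + bε` to at most `s`, and `m` steps of length `σ`
  -- then lead just beyond `s`, into the window.
  set b := ⌊x / (η - ε)⌋ with hb
  set a := ⌊s - b * ε⌋ with ha
  set m := ⌊(s - (a + b * ε)) / σ⌋ + 1 with hm
  have ha1 : (a : ℝ) ≤ s - b * ε := Int.floor_le _
  have ha2 : s - b * ε < a + 1 := Int.lt_floor_add_one _
  have hm1 : ((m : ℝ) - 1) * σ ≤ s - (a + b * ε) := by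
    rw [← le_div_iff₀ hσ0, hm]; push_cast; linarith [Int.floor_le ((s - (a + b * ε)) / σ)]
  have hm2 : s - (a + b * ε) < m * σ := by
    rw [← div_lt_iff₀ hσ0, hm]; push_cast; linarith [Int.lt_floor_add_one ((s - (a + b * ε)) / σ)]
  have hb1 : b * (η - ε) ≤ x := by rw [← le_div_iff₀ hδ']; exact Int.floor_le _
  have hb2 : x < (b + 1) * (η - ε) := by rw [← div_lt_iff₀ hδ']; exact Int.lt_floor_add_one _
  have hm0 : (0 : ℝ) ≤ m := by
    have : (0 : ℝ) < m * σ := by linarith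
    exact (pos_of_mul_pos_left this hσ0.le).le
  have hmle : (m : ℝ) ≤ 1 / σ + 1 := by
    have : (m : ℝ) - 1 ≤ 1 / σ := by rw [le_div_iff₀ hσ0]; linarith
    linarith
  have hy1 : s < a + b * ε + m * σ := by linarith
  have hy2 : a + b * ε + m * σ < t := by linarith
  refine ⟨(a + m * j : ℤ) + (b + m * k : ℤ) * η, ⟨_, _, rfl, hA ?_⟩, ?_⟩
  · push_cast
    rw [hσ] at hy1 hy2
    constructor <;> linarith
  · have hkey : x - ((a + m * j : ℤ) + (b + m * k : ℤ) * η)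
        = (x - b * (η - ε)) + (-(a + b * ε + m * σ)) + (-(m * k * (η - ε))) := by
      rw [hσ]; push_cast; ring
    rw [hkey]
    have e1 : |x - b * (η - ε)| ≤ η - ε := by rw [abs_le]; constructor <;> linarith
    have e2 : |(-(a + b * ε + m * σ))| ≤ |s| + |t| := by
      rw [abs_neg, abs_le]
      constructor <;> linarith [neg_abs_le s, abs_nonneg t, abs_nonneg s, le_abs_self t]
    have e3 : |(-(m * k * (η - ε)))| ≤ (1 / σ + 1) * |(k : ℝ)| * (η - ε) := by
      rw [abs_neg, abs_mul, abs_mul, abs_of_nonneg hm0, abs_of_pos hδ']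
      gcongr
    linarith [abs_add_three (x - b * (η - ε)) (-(a + b * ε + m * σ)) (-(m * k * (η - ε)))]

lemma isDelone_cutProject {ε η s t : ℝ} (hε : Irrational ε) (hδ : ε < η) (hst : s < t)
    {A : Set ℝ} (h1 : Set.Ioo s t ⊆ A) (h2 : A ⊆ Set.Icc s t) : IsDelone (cutProject ε η A) := by
  obtain ⟨r, hr, hsep⟩ := exists_separation_cutProject hδ h2
  obtain ⟨L, hL⟩ := exists_covering_cutProject hε hδ hst h1
  exact isDelone_of_real hr hsep hL

lemma isIncreasingEnumeration_cutProject {ε η s t : ℝ} (hε : Irrational ε) (hδ : ε < η)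
    (hst : s < t) {A : Set ℝ} (h1 : Set.Ioo s t ⊆ A) (h2 : A ⊆ Set.Icc s t) :
    IsIncreasingEnumeration (enumeration (cutProject ε η A)) (cutProject ε η A) := by
  obtain ⟨L, hL⟩ := exists_covering_cutProject hε hδ hst h1
  refine enumeration_spec (exists_isIncreasingEnumeration (finite_cutProject_inter hδ h2) ?_ ?_)
  · intro x
    obtain ⟨y, hy, hxy⟩ := hL (x + L + 1)
    exact ⟨y, hy, by linarith [(abs_le.1 hxy).2]⟩
  · intro x
    obtain ⟨y, hy, hxy⟩ := hL (x - L - 1)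
    exact ⟨y, hy, by linarith [(abs_le.1 hxy).1]⟩

lemma finite_range_cutProjectWord {ε η s t : ℝ} (hε : Irrational ε) (hδ : ε < η)
    (hst : s < t) {A : Set ℝ} (h1 : Set.Ioo s t ⊆ A) (h2 : A ⊆ Set.Icc s t) :
    (Set.range (cutProjectWord ε η A)).Finite := by
  obtain ⟨L, hL⟩ := exists_covering_cutProject hε hδ hst h1
  obtain ⟨hmono, hrange, -, -⟩ := isIncreasingEnumeration_cutProject hε hδ hst h1 h2
  unfold cutProjectWord gapWord
  set x := enumeration (cutProject ε η A)
  have hmem : ∀ n, x n ∈ cutProject ε η A := fun n => hrange ▸ Set.mem_range_self n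
  refine (finite_differences hδ h2 (2 * L + 1)).subset ?_
  rintro _ ⟨n, rfl⟩
  refine ⟨?_, _, hmem _, _, hmem _, rfl⟩
  have hpos : x n < x (n + 1) := hmono (lt_add_one n)
  rw [abs_of_pos (sub_pos.2 hpos)]
  obtain ⟨y, hy, hxy⟩ := hL (x n + L + 1)
  rw [← hrange] at hy
  obtain ⟨j, rfl⟩ := hy
  have h := abs_le.1 hxy
  have hj : n < j := hmono.lt_iff_lt.1 (by linarith [h.2])
  have := hmono.monotone (Int.add_one_le_of_lt hj)
  linarith [h.1]

/-! ### Bounded distance equivalence and uniform density -/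

lemma ncard_inter_Ico_le_of_injective {Λ Λ' : Set ℝ} {C u v : ℝ} (g : Λ → Λ')
    (hg : Function.Injective g) (hC : ∀ x : Λ, |(x : ℝ) - g x| ≤ C)
    (hfin : (Λ' ∩ Set.Ico (u - C) (v + C)).Finite) :
    (Λ ∩ Set.Ico u v).Finite ∧
      (Λ ∩ Set.Ico u v).ncard ≤ (Λ' ∩ Set.Ico (u - C) (v + C)).ncard := by
  classical
  set f : ℝ → ℝ := fun x => if hx : x ∈ Λ then (g ⟨x, hx⟩ : ℝ) else 0 with hf
  have hmaps : Set.MapsTo f (Λ ∩ Set.Ico u v) (Λ' ∩ Set.Ico (u - C) (v + C)) := by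
    rintro x ⟨hx, h1, h2⟩
    have h3 := abs_le.1 (hC ⟨x, hx⟩)
    simp only [hf, hx, dite_true]
    dsimp only at h3
    exact ⟨Subtype.coe_prop _, by linarith [h3.2], by linarith [h3.1]⟩
  have hinj : Set.InjOn f (Λ ∩ Set.Ico u v) := by
    rintro x ⟨hx, -⟩ y ⟨hy, -⟩ hxy
    simp only [hf, hx, hy, dite_true] at hxy
    exact congrArg Subtype.val (hg (Subtype.ext hxy))
  exact ⟨Set.Finite.of_injOn hmaps hinj hfin, Set.ncard_le_ncard_of_injOn f hmaps hinj hfin⟩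

/-- Uniform density is invariant under bounded distance equivalence. -/
lemma HasUniformDensity.of_equiv {Λ Λ' : Set ℝ} {κ C : ℝ} (h : HasUniformDensity Λ' κ)
    (hC0 : 0 ≤ C) (g : Λ ≃ Λ') (hg : ∀ x : Λ, |(x : ℝ) - g x| ≤ C) :
    HasUniformDensity Λ κ := by
  obtain ⟨B, hB⟩ := h
  have hg' : ∀ y : Λ', |(y : ℝ) - g.symm y| ≤ C := fun y => by
    simpa [abs_sub_comm] using hg (g.symm y)
  have hup := fun u v (huv : u ≤ v) =>
    ncard_inter_Ico_le_of_injective g g.injective hg (hB (u - C) (v + C) (by linarith)).1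
  refine ⟨B + |κ| * (2 * C), fun u v huv => ⟨(hup u v huv).1, ?_⟩⟩
  have herr : ∀ w : ℝ, |w - (v - u)| ≤ 2 * C → |κ * w - κ * (v - u)| ≤ |κ| * (2 * C) := by
    intro w hw
    rw [← mul_sub, abs_mul]
    exact mul_le_mul_of_nonneg_left hw (abs_nonneg _)
  rw [abs_le]
  constructor
  · have hcard : (Λ' ∩ Set.Ico (u + C) (max (u + C) (v - C))).ncard
        ≤ (Λ ∩ Set.Ico u v).ncard := by
      rcases le_total (v - C) (u + C) with hle | hle
      · rw [max_eq_left hle]; simp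
      · have := ncard_inter_Ico_le_of_injective (u := u + C) (v := v - C) g.symm g.symm.injective
          hg' (by simpa using (hup u v huv).1)
        simpa [max_eq_right hle] using this.2
    have hcard' : ((Λ' ∩ Set.Ico (u + C) (max (u + C) (v - C))).ncard : ℝ)
        ≤ (Λ ∩ Set.Ico u v).ncard := by exact_mod_cast hcard
    have h1 := abs_le.1 (hB (u + C) (max (u + C) (v - C)) (le_max_left _ _)).2
    have h2 := abs_le.1 (herr (max (u + C) (v - C) - (u + C)) (by
      rw [abs_le]
      constructor
      · linarith [le_max_right (u + C) (v - C)]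
      · have : max (u + C) (v - C) ≤ v + C := max_le (by linarith) (by linarith)
        linarith))
    linarith
  · have hcard : ((Λ ∩ Set.Ico u v).ncard : ℝ)
        ≤ (Λ' ∩ Set.Ico (u - C) (v + C)).ncard := by
      exact_mod_cast (hup u v huv).2
    have h1 := abs_le.1 (hB (u - C) (v + C) (by linarith)).2
    have h2 := abs_le.1 (herr (v + C - (u - C)) (by rw [abs_le]; constructor <;> linarith))
    linarith

lemma hasUniformDensity_zmultiples {τ : ℝ} (hτ : 0 < τ) :
    HasUniformDensity (AddSubgroup.zmultiples τ : Set ℝ) (1 / τ) := by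
  refine ⟨1, fun u v huv => ?_⟩
  have himg : (AddSubgroup.zmultiples τ : Set ℝ) ∩ Set.Ico u v
      = (fun n : ℤ => n • τ) '' (Finset.Ico ⌈u / τ⌉ ⌈v / τ⌉ : Finset ℤ) := by
    ext x
    simp only [Set.mem_inter_iff, SetLike.mem_coe, AddSubgroup.mem_zmultiples_iff, Set.mem_image,
      Finset.mem_Ico, Int.ceil_le, Int.lt_ceil, Set.mem_Ico, div_le_iff₀ hτ,
      lt_div_iff₀ hτ, zsmul_eq_mul]
    constructor
    · rintro ⟨⟨n, rfl⟩, h⟩; exact ⟨n, h, rfl⟩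
    · rintro ⟨n, h, rfl⟩; exact ⟨⟨n, rfl⟩, h⟩
  have hinj : Function.Injective fun n : ℤ => n • τ := fun m n h => by
    simpa [hτ.ne'] using h
  rw [himg]
  refine ⟨(Finset.finite_toSet _).image _, ?_⟩
  rw [Set.ncard_image_of_injective _ hinj, Set.ncard_coe_finset, Int.card_Ico]
  have huv' : u / τ ≤ v / τ := by gcongr
  rw [← Int.cast_natCast, Int.toNat_of_nonneg (sub_nonneg.2 (Int.ceil_mono huv'))]
  have h : 1 / τ * (v - u) = v / τ - u / τ := by ring
  rw [h, abs_le]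
  push_cast
  have := Int.le_ceil (u / τ)
  have := Int.le_ceil (v / τ)
  have := Int.ceil_lt_add_one (u / τ)
  have := Int.ceil_lt_add_one (v / τ)
  constructor <;> linarith

/-- A discrete subgroup spanning the line is `τℤ` for some `τ > 0`, and uniform density passes from
it to every set at bounded distance. -/
lemma IsBDL.exists_hasUniformDensity {Λ : Set ℝ} (h : IsBDL Λ) :
    ∃ κ, HasUniformDensity Λ κ := by
  obtain ⟨L, -, -, -, hL, C, hC, g, hg⟩ := h
  obtain ⟨r, hr, hsep⟩ := hL.exists_separation
  obtain ⟨R, hcov⟩ := hL.exists_covering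
  -- A dense subgroup would have points closer to `0` than the packing radius.
  rcases AddSubgroup.dense_or_cyclic L.toAddSubgroup with hd | ⟨a, ha⟩
  · exfalso
    obtain ⟨y, hy, h0, h1⟩ := hd.exists_between hr
    have := hsep y hy 0 L.zero_mem h0.ne'
    rw [sub_zero, abs_of_pos h0] at this
    linarith
  · have hmem : (L : Set ℝ) = (AddSubgroup.zmultiples a : Set ℝ) := by
      rw [AddSubgroup.zmultiples_eq_closure, ← ha]; rfl
    have ha0 : a ≠ 0 := by
      rintro rfl
      obtain ⟨y, hy, hxy⟩ := hcov (R + 1)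
      rw [hmem] at hy
      have : y = 0 := by simpa using hy
      rw [this, sub_zero] at hxy
      linarith [le_abs_self (R + 1)]
    have habs : (L : Set ℝ) = (AddSubgroup.zmultiples |a| : Set ℝ) := by
      rw [hmem]
      rcases abs_choice a with h | h
      · rw [h]
      · rw [h, AddSubgroup.zmultiples_neg]
    refine ⟨1 / |a|, HasUniformDensity.of_equiv (Λ' := L) ?_ hC.le g fun x => (hg x).le⟩
    rw [habs]
    exact hasUniformDensity_zmultiples (abs_pos.2 ha0)

lemma ncard_range_inter_Ico {x : ℤ → ℝ} (hx : StrictMono x) {m n : ℤ} (hmn : m ≤ n) :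
    ((Set.range x ∩ Set.Ico (x m) (x n)).ncard : ℝ) = n - m := by
  have : Set.range x ∩ Set.Ico (x m) (x n) = x '' (Finset.Ico m n : Finset ℤ) := by
    ext y
    constructor
    · rintro ⟨⟨k, rfl⟩, h1, h2⟩
      exact ⟨k, by simpa using ⟨hx.le_iff_le.1 h1, hx.lt_iff_lt.1 h2⟩, rfl⟩
    · rintro ⟨k, hk, rfl⟩
      have hk' : m ≤ k ∧ k < n := by simpa using hk
      exact ⟨⟨k, rfl⟩, hx.le_iff_le.2 hk'.1, hx.lt_iff_lt.2 hk'.2⟩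
  rw [this, Set.ncard_image_of_injective _ hx.injective, Set.ncard_coe_finset, Int.card_Ico,
    ← Int.cast_natCast, Int.toNat_of_nonneg (by omega)]
  push_cast; rfl

/-- A set of uniform density stays within bounded distance of an arithmetic progression. -/
lemma HasUniformDensity.exists_abs_sub_le {x : ℤ → ℝ} {κ : ℝ} (hx : StrictMono x)
    (h : HasUniformDensity (Set.range x) κ) (hκ : 0 < κ) :
    ∃ C, ∀ n : ℤ, |x n - n * (1 / κ)| ≤ C := by
  obtain ⟨B, hB⟩ := h
  have hdiff : ∀ m n : ℤ, m ≤ n → |(x n - x m) - (n - m) * (1 / κ)| ≤ B * (1 / κ) := by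
    intro m n hmn
    have h1 := (hB (x m) (x n) (hx.monotone hmn)).2
    rw [ncard_range_inter_Ico hx hmn] at h1
    have h2 : (x n - x m) - (n - m) * (1 / κ) = -((n - m : ℝ) - κ * (x n - x m)) * (1 / κ) := by
      field_simp; ring
    rw [h2, abs_mul, abs_neg, abs_of_pos (one_div_pos.2 hκ)]
    gcongr
  refine ⟨B * (1 / κ) + |x 0|, fun n => ?_⟩
  have hx0 := abs_le.1 (le_refl |x 0|)
  rcases le_total 0 n with hn | hn
  · have h := abs_le.1 (hdiff 0 n hn)
    push_cast at h
    rw [abs_le]; constructor <;> linarith [h.1, h.2, hx0.1, hx0.2]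
  · have h := abs_le.1 (hdiff n 0 hn)
    push_cast at h
    rw [abs_le]; constructor <;> linarith [h.1, h.2, hx0.1, hx0.2]

lemma exists_equiv_zmultiples {x : ℤ → ℝ} (hx : StrictMono x) {τ : ℝ} (hτ : 0 < τ) :
    ∃ g : Set.range x ≃ (AddSubgroup.zmultiples τ : Set ℝ), ∀ n : ℤ,
      (g ⟨x n, Set.mem_range_self n⟩ : ℝ) = n * τ := by
  have hinj : Function.Injective fun n : ℤ => n • τ := fun m n h => by
    simpa [hτ.ne'] using h
  refine ⟨(Equiv.ofInjective x hx.injective).symm.trans ((Equiv.ofInjective _ hinj).trans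
    (Equiv.setCongr (AddSubgroup.coe_zmultiples τ).symm)), fun n => ?_⟩
  have : (Equiv.ofInjective x hx.injective).symm ⟨x n, Set.mem_range_self n⟩ = n :=
    Equiv.ofInjective_symm_apply hx.injective n
  rw [Equiv.trans_apply, this]
  exact zsmul_eq_mul τ n

lemma hasUniformDensity_of_abs_sub_le {x : ℤ → ℝ} (hx : StrictMono x) {τ C : ℝ} (hτ : 0 < τ)
    (h : ∀ n : ℤ, |x n - n * τ| ≤ C) : HasUniformDensity (Set.range x) (1 / τ) := by
  obtain ⟨g, hg⟩ := exists_equiv_zmultiples hx hτ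
  refine (hasUniformDensity_zmultiples hτ).of_equiv ((abs_nonneg _).trans (h 0)) g ?_
  rintro ⟨_, n, rfl⟩
  rw [hg]; exact h n

lemma boundedDistEquiv_of_abs_sub_le {x : ℤ → ℝ} (hx : StrictMono x) (hd : IsDelone (Set.range x))
    {τ C : ℝ} (hτ : 0 < τ) (h : ∀ n : ℤ, |x n - n * τ| ≤ C) :
    BoundedDistEquiv (Set.range x) (AddSubgroup.zmultiples τ : Set ℝ) := by
  obtain ⟨g, hg⟩ := exists_equiv_zmultiples hx hτ
  refine ⟨hd, isDelone_zmultiples hτ, C + 1, by linarith [(abs_nonneg _).trans (h 0)], g, ?_⟩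
  rintro ⟨_, n, rfl⟩
  rw [hg, Real.dist_eq]
  linarith [h n]

lemma BoundedDistEquiv.isBDL {Λ : Set ℝ} {τ : ℝ} (hτ : τ ≠ 0)
    (h : BoundedDistEquiv Λ (AddSubgroup.zmultiples τ : Set ℝ)) : IsBDL Λ := by
  have hdisc : DiscreteTopology (AddSubgroup.toIntSubmodule (AddSubgroup.zmultiples τ)) :=
    inferInstanceAs (DiscreteTopology (AddSubgroup.zmultiples τ))
  refine ⟨AddSubgroup.toIntSubmodule (AddSubgroup.zmultiples τ), hdisc, ⟨?_⟩, h⟩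
  rw [Submodule.eq_top_iff']
  intro y
  have hmem : τ ∈ Submodule.span ℝ
      (AddSubgroup.toIntSubmodule (AddSubgroup.zmultiples τ) : Set ℝ) :=
    Submodule.subset_span (AddSubgroup.mem_zmultiples τ)
  have := Submodule.smul_mem _ (y / τ) hmem
  rwa [smul_eq_mul, div_mul_cancel₀ _ hτ] at this

/-! ### Balanced words -/

lemma sum_factorAt_gap (x : ℤ → ℝ) (i : ℤ) (n : ℕ) :
    (factorAt (fun k => x (k + 1) - x k) i n).sum = x (i + n) - x i := by
  unfold factorAt
  rw [List.sum_ofFn, Fin.sum_univ_eq_sum_range (fun k : ℕ => x (i + k + 1) - x (i + k)) n]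
  have h := Finset.sum_range_sub (fun k : ℕ => x (i + k)) n
  rw [Nat.cast_zero, add_zero] at h
  rw [← h]
  exact Finset.sum_congr rfl fun k _ => by congr 2; push_cast; ring

open Classical in
lemma count_factorAt {A : Type*} (u : ℤ → A) (i : ℤ) (n : ℕ) (a : A) :
    ((factorAt u i n).count a : ℝ) = ∑ k ∈ Finset.range n, if u (i + k) = a then 1 else 0 := by
  induction n with
  | zero => simp [factorAt]
  | succ n ih =>
    have : factorAt u i (n + 1) = factorAt u i n ++ [u (i + n)] := by
      unfold factorAt
      rw [List.ofFn_succ_last]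
      simp
    rw [this, List.count_append, Finset.sum_range_succ, ← ih, List.count_singleton]
    push_cast
    simp

/-- In a balanced word over a finite alphabet of gaps, the total gaps of factors of equal length
differ by a bounded amount. -/
lemma IsBalanced.exists_abs_sub_le {x : ℤ → ℝ} (hb : IsBalanced fun k => x (k + 1) - x k)
    (hfin : (Set.range fun k => x (k + 1) - x k).Finite) :
    ∃ K, ∀ (i j : ℤ) (n : ℕ), |(x (i + n) - x i) - (x (j + n) - x j)| ≤ K := by
  classical
  obtain ⟨c, hc, hbal⟩ := hb
  set u : ℤ → ℝ := fun k => x (k + 1) - x k with hu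
  have hsum : ∀ (i : ℤ) (n : ℕ), x (i + n) - x i
      = ∑ a ∈ hfin.toFinset, ((factorAt u i n).count a : ℝ) * a := by
    intro i n
    rw [← sum_factorAt_gap, Finset.sum_list_count_of_subset (factorAt u i n) hfin.toFinset]
    · simp only [nsmul_eq_mul]
    · intro a ha
      simp only [factorAt, List.mem_toFinset, List.mem_ofFn] at ha
      obtain ⟨k, rfl⟩ := ha
      simp
  refine ⟨∑ a ∈ hfin.toFinset, c * |a|, fun i j n => ?_⟩
  rw [hsum, hsum, ← Finset.sum_sub_distrib]
  refine (Finset.abs_sum_le_sum_abs _ _).trans (Finset.sum_le_sum fun a _ => ?_)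
  rw [← sub_mul, abs_mul]
  refine mul_le_mul_of_nonneg_right ?_ (abs_nonneg a)
  have hlen : (factorAt u i n).length = (factorAt u j n).length := by simp [factorAt]
  have h1 := hbal _ _ ⟨i, n, rfl⟩ ⟨j, n, rfl⟩ hlen a
  have h2 := hbal _ _ ⟨j, n, rfl⟩ ⟨i, n, rfl⟩ hlen.symm a
  rw [abs_le]
  constructor
  · convert neg_le_neg h2 using 1
    rw [neg_sub]
  · convert h1 using 1

/-- A quasi-additive sequence is at bounded distance from a linear one. -/
lemma exists_linear_of_quasiadditive {f : ℕ → ℝ} {K : ℝ}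
    (h : ∀ m n : ℕ, |f (m + n) - f m - f n| ≤ K) : ∃ τ, ∀ n : ℕ, |f n - n * τ| ≤ K := by
  have hK : 0 ≤ K := (abs_nonneg _).trans (h 0 0)
  -- Comparing `f (mn)` with both `m f(n)` and `n f(m)` separates the lower from the upper slopes.
  have hmul : ∀ m n : ℕ, |f ((m + 1) * n) - (m + 1) * f n| ≤ m * K := by
    intro m n
    induction m with
    | zero => simp
    | succ m ih =>
      have h1 := abs_le.1 (h ((m + 1) * n) n)
      rw [← Nat.succ_mul] at h1
      have h2 := abs_le.1 ih
      rw [abs_le]; push_cast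
      constructor <;> linarith [h1.1, h1.2, h2.1, h2.2]
  have hle : ∀ m n : ℕ, (f (m + 1) - K) / (m + 1) ≤ (f (n + 1) + K) / (n + 1) := by
    intro m n
    rw [div_le_div_iff₀ (by positivity) (by positivity)]
    have h1 := abs_le.1 (hmul n (m + 1))
    have h2 := abs_le.1 (hmul m (n + 1))
    rw [mul_comm (m + 1) (n + 1)] at h2
    nlinarith [h1.1, h1.2, h2.1, h2.2]
  obtain ⟨τ, h1, h2⟩ := exists_between_of_forall_le
    (s := Set.range fun m : ℕ => (f (m + 1) - K) / (m + 1))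
    (t := Set.range fun n : ℕ => (f (n + 1) + K) / (n + 1))
    (Set.range_nonempty _) (Set.range_nonempty _)
    (by rintro _ ⟨m, rfl⟩ _ ⟨n, rfl⟩; exact hle m n)
  refine ⟨τ, fun n => ?_⟩
  rcases n with _ | n
  · simpa using h 0 0
  · have h3 := h1 ⟨n, rfl⟩
    have h4 := h2 ⟨n, rfl⟩
    dsimp only at h3 h4
    rw [div_le_iff₀ (by positivity)] at h3
    rw [le_div_iff₀ (by positivity)] at h4
    rw [abs_le]; push_cast
    constructor <;> linarith

lemma IsBalanced.exists_hasUniformDensity {x : ℤ → ℝ} (hx : StrictMono x)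
    (hd : IsDelone (Set.range x)) (hb : IsBalanced fun k => x (k + 1) - x k)
    (hfin : (Set.range fun k => x (k + 1) - x k).Finite) :
    ∃ κ, HasUniformDensity (Set.range x) κ := by
  obtain ⟨K, hK⟩ := hb.exists_abs_sub_le hfin
  obtain ⟨r, hr, hsep⟩ := hd.exists_separation
  obtain ⟨τ, hτ⟩ := exists_linear_of_quasiadditive (f := fun n : ℕ => x n - x 0) (K := K) (by
    intro m n
    have := hK m 0 n
    push_cast
    rw [zero_add] at this
    convert this using 2; ring)
  have hgrow : ∀ n : ℕ, r * n ≤ x n - x 0 := by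
    intro n
    induction n with
    | zero => simp
    | succ n ih =>
      have h1 : x n < x (n + 1) := hx (lt_add_one _)
      have h2 := hsep _ ⟨_, rfl⟩ _ ⟨_, rfl⟩ h1.ne'
      rw [abs_of_pos (sub_pos.2 h1)] at h2
      push_cast; linarith
  -- The sequence grows at least at the rate `r`, so its slope cannot be nonpositive.
  have hτ0 : 0 < τ := by
    by_contra! hle
    obtain ⟨n, hn⟩ := exists_nat_gt (K / r)
    rw [div_lt_iff₀ hr] at hn
    have h1 := (abs_le.1 (hτ n)).2
    have h2 := hgrow n
    have h3 : n * τ ≤ 0 := mul_nonpos_of_nonneg_of_nonpos (Nat.cast_nonneg n) hle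
    linarith
  refine ⟨1 / τ, hasUniformDensity_of_abs_sub_le (C := 2 * K + |x 0|) hx hτ0 fun n => ?_⟩
  have h0 := abs_le.1 (le_refl |x 0|)
  have hK0 : 0 ≤ K := (abs_nonneg _).trans (hK 0 0 0)
  obtain ⟨m, rfl | rfl⟩ := n.eq_nat_or_neg
  · have h1 := abs_le.1 (hτ m)
    rw [abs_le, Int.cast_natCast]
    constructor <;> linarith [h1.1, h1.2, h0.1, h0.2]
  · have h1 := abs_le.1 (hτ m)
    have h2 := abs_le.1 (hK (-m) 0 m)
    rw [neg_add_cancel, zero_add] at h2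
    rw [abs_le]; push_cast
    constructor <;> linarith [h1.1, h1.2, h0.1, h0.2, h2.1, h2.2]

/-! ### Balancedness of the coding word -/

/-- The number of visits of the sequence `x` to the set `S` during `n` steps from time `i`. -/
noncomputable def visits (x : ℤ → ℝ) (S : Set ℝ) (i : ℤ) (n : ℕ) : ℝ :=
  ∑ k ∈ Finset.range n, S.indicator 1 (x (i + k))

/-- The visits of the sequence `x` to `S` have a frequency, up to a bounded error in their
number. -/
def HasFrequency (x : ℤ → ℝ) (S : Set ℝ) : Prop :=
  ∃ κ C : ℝ, ∀ (i : ℤ) (n : ℕ), |visits x S i n - κ * n| ≤ C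

lemma HasFrequency.diff {x : ℤ → ℝ} {S T : Set ℝ} (hTS : T ⊆ S) (hS : HasFrequency x S)
    (hT : HasFrequency x T) : HasFrequency x (S \ T) := by
  obtain ⟨κ, C, h⟩ := hS
  obtain ⟨κ', C', h'⟩ := hT
  refine ⟨κ - κ', C + C', fun i n => ?_⟩
  have hv : visits x (S \ T) i n = visits x S i n - visits x T i n := by
    unfold visits
    rw [← Finset.sum_sub_distrib]
    exact Finset.sum_congr rfl fun k _ => by rw [Set.indicator_sdiff hTS]; rfl
  have h1 := abs_le.1 (h i n)
  have h2 := abs_le.1 (h' i n)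
  rw [hv, abs_le]
  constructor <;> linarith [h1.1, h1.2, h2.1, h2.2]

/-- Inclusion-exclusion: bounded-error frequencies pass from a family of sets that is closed under
intersections to the Boolean combinations that remove finitely many members from one. -/
lemma hasFrequency_diff_biUnion {x : ℤ → ℝ} {F : Set (Set ℝ)}
    (hinter : ∀ S ∈ F, ∀ T ∈ F, S ∩ T ∈ F) (hfreq : ∀ S ∈ F, HasFrequency x S)
    {ι : Type*} (E : Finset ι) (B : ι → Set ℝ) (hB : ∀ e ∈ E, B e ∈ F) :
    ∀ S ∈ F, HasFrequency x (S \ ⋃ e ∈ E, B e) := by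
  classical
  induction E using Finset.induction_on with
  | empty => intro S hS; simpa using hfreq S hS
  | insert e E _ ih =>
    intro S hS
    have ih' := ih fun e' he' => hB e' (Finset.mem_insert_of_mem he')
    have hBe := hB e (Finset.mem_insert_self e E)
    have heq : S \ ⋃ e' ∈ insert e E, B e'
        = (S \ ⋃ e' ∈ E, B e') \ ((S ∩ B e) \ ⋃ e' ∈ E, B e') := by
      ext y
      simp only [Finset.set_biUnion_insert, Set.mem_sdiff, Set.mem_union, Set.mem_inter_iff]
      tauto
    rw [heq]
    exact (ih' S hS).diff (Set.sdiff_subset_sdiff_left Set.inter_subset_left)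
      (ih' _ (hinter S hS _ hBe))

lemma sub_mem_ZAdd {ε p q : ℝ} (hp : p ∈ ZAdd ε) (hq : q ∈ ZAdd ε) : p - q ∈ ZAdd ε := by
  obtain ⟨a, b, rfl⟩ := hp
  obtain ⟨c, d, rfl⟩ := hq
  exact ⟨a - c, b - d, by push_cast; ring⟩

lemma zero_mem_ZAdd (ε : ℝ) : (0 : ℝ) ∈ ZAdd ε := ⟨0, 0, by simp⟩

/-- Intervals with both endpoints, included or not, in the coset `c + ℤ + ℤε`; empty ones are
allowed, as intervals with endpoints in the wrong order. -/
def IsCosetInterval (ε c : ℝ) (A : Set ℝ) : Prop :=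
  ∃ s t : ℝ, s - c ∈ ZAdd ε ∧ t - c ∈ ZAdd ε ∧ Set.Ioo s t ⊆ A ∧ A ⊆ Set.Icc s t

lemma IsCosetInterval.inter {ε c : ℝ} {A B : Set ℝ} (hA : IsCosetInterval ε c A)
    (hB : IsCosetInterval ε c B) : IsCosetInterval ε c (A ∩ B) := by
  obtain ⟨s, t, hs, ht, h1, h2⟩ := hA
  obtain ⟨s', t', hs', ht', h1', h2'⟩ := hB
  refine ⟨max s s', min t t', ?_, ?_, ?_, ?_⟩
  · rcases max_choice s s' with h | h <;> rwa [h]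
  · rcases min_choice t t' with h | h <;> rwa [h]
  · rw [← Set.Ioo_inter_Ioo]; exact Set.inter_subset_inter h1 h1'
  · rw [← Set.Icc_inter_Icc]; exact Set.inter_subset_inter h2 h2'

lemma IsCosetInterval.preimage_add {ε c p : ℝ} (hp : p ∈ ZAdd ε) {A : Set ℝ}
    (hA : IsCosetInterval ε c A) : IsCosetInterval ε c ((· + p) ⁻¹' A) := by
  obtain ⟨s, t, hs, ht, h1, h2⟩ := hA
  refine ⟨s - p, t - p, ?_, ?_, ?_, ?_⟩
  · rw [sub_right_comm]; exact sub_mem_ZAdd hs hp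
  · rw [sub_right_comm]; exact sub_mem_ZAdd ht hp
  · rw [← Set.preimage_add_const_Ioo]; exact Set.preimage_mono h1
  · rw [← Set.preimage_add_const_Icc]; exact Set.preimage_mono h2

lemma cutProject_inter {ε η : ℝ} (hη : Irrational η) (A B : Set ℝ) :
    cutProject ε η A ∩ cutProject ε η B = cutProject ε η (A ∩ B) := by
  ext x
  constructor
  · rintro ⟨⟨a, b, rfl, hab⟩, c, d, h, hcd⟩
    have hinj := @int_add_mul_injective η hη (a, b) (c, d) h
    simp only [Prod.mk.injEq] at hinj
    obtain ⟨rfl, rfl⟩ := hinj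
    exact ⟨a, b, rfl, hab, hcd⟩
  · rintro ⟨a, b, rfl, hA, hB⟩
    exact ⟨⟨a, b, rfl, hA⟩, a, b, rfl, hB⟩

lemma preimage_add_cutProject (ε η : ℝ) (p q : ℤ) (A : Set ℝ) :
    (· + ((p : ℝ) + q * η)) ⁻¹' cutProject ε η A
      = cutProject ε η ((· + ((p : ℝ) + q * ε)) ⁻¹' A) := by
  ext x
  constructor
  · rintro ⟨a, b, h, hab⟩
    refine ⟨a - p, b - q, ?_, ?_⟩
    · dsimp only at h; push_cast; linarith
    · rw [Set.mem_preimage]; convert hab using 1; push_cast; ring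
  · rintro ⟨a, b, rfl, hab⟩
    refine ⟨a + p, b + q, by push_cast; ring, ?_⟩
    rw [Set.mem_preimage] at hab; convert hab using 1; push_cast; ring

lemma IsCosetInterval.exists_hasUniformDensity {ε η c : ℝ} (hε : Irrational ε)
    (hη : Irrational η) (hδ : ε < η) {A : Set ℝ} (hA : IsCosetInterval ε c A) :
    ∃ κ, HasUniformDensity (cutProject ε η A) κ := by
  obtain ⟨s, t, hs, ht, h1, h2⟩ := hA
  rcases le_or_gt s t with hst | hst
  · have hmem : t - s ∈ ZAdd ε := by
      have := sub_mem_ZAdd ht hs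
      rwa [sub_sub_sub_cancel_right] at this
    exact ⟨_, (hasBoundedRemainder_of_mem_ZAdd hε hst h1 h2 hmem).hasUniformDensity hη hδ h2⟩
  · rw [Set.Icc_eq_empty (not_le.2 hst), Set.subset_empty_iff] at h2
    refine ⟨0, 0, fun u v _ => ?_⟩
    have : cutProject ε η A = ∅ := by
      rw [h2]
      exact Set.eq_empty_of_forall_notMem fun x ⟨a, b, _, h⟩ => h
    simp [this]

lemma visits_eq_ncard {x : ℤ → ℝ} (hx : StrictMono x) {S : Set ℝ} (hS : S ⊆ Set.range x)
    (i : ℤ) (n : ℕ) : visits x S i n = (S ∩ Set.Ico (x i) (x (i + n))).ncard := by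
  classical
  have himg : S ∩ Set.Ico (x i) (x (i + n))
      = (fun k : ℕ => x (i + k)) '' ((Finset.range n).filter fun k => x (i + k) ∈ S : Finset ℕ) := by
    ext y
    constructor
    · rintro ⟨hy, h1, h2⟩
      obtain ⟨k, rfl⟩ := hS hy
      have hk1 := hx.le_iff_le.1 h1
      have hk2 := hx.lt_iff_lt.1 h2
      have hk : i + ((k - i).toNat : ℤ) = k := by omega
      refine ⟨(k - i).toNat, ?_, by dsimp only; rw [hk]⟩
      simp only [Finset.coe_filter, Finset.mem_range, Set.mem_ofPred_eq, hk]
      exact ⟨by omega, hy⟩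
    · rintro ⟨k, hk, rfl⟩
      simp only [Finset.coe_filter, Finset.mem_range, Set.mem_ofPred_eq] at hk
      exact ⟨hk.2, hx.monotone (by omega), hx (by have := hk.1; omega)⟩
  have hinj : Function.Injective fun k : ℕ => x (i + k) := fun k l h => by
    have := hx.injective h
    omega
  rw [himg, Set.ncard_image_of_injective _ hinj, Set.ncard_coe_finset, Finset.card_filter]
  unfold visits
  push_cast
  exact Finset.sum_congr rfl fun k _ => by simp [Set.indicator_apply]

lemma visits_inter_range (x : ℤ → ℝ) (S : Set ℝ) (i : ℤ) (n : ℕ) :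
    visits x (S ∩ Set.range x) i n = visits x S i n := by
  unfold visits
  exact Finset.sum_congr rfl fun k _ => by
    by_cases h : x (i + k) ∈ S <;> simp [h]

/-- If `x` is close to an arithmetic progression, it visits sets of uniform density with bounded
error. -/
lemma HasUniformDensity.hasFrequency {x : ℤ → ℝ} (hx : StrictMono x) {τ C κ : ℝ}
    (hτ : ∀ n : ℤ, |x n - n * τ| ≤ C) {S : Set ℝ}
    (h : HasUniformDensity (S ∩ Set.range x) κ) : HasFrequency x S := by
  obtain ⟨B, hB⟩ := h
  refine ⟨κ * τ, B + |κ| * (2 * C), fun i n => ?_⟩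
  rw [← visits_inter_range, visits_eq_ncard hx Set.inter_subset_right]
  have h1 := abs_le.1 (hB (x i) (x (i + n)) (hx.monotone (by omega))).2
  have h2 : |κ * (x (i + n) - x i) - κ * τ * n| ≤ |κ| * (2 * C) := by
    rw [show κ * (x (i + n) - x i) - κ * τ * n = κ * (x (i + n) - x i - n * τ) by ring, abs_mul]
    refine mul_le_mul_of_nonneg_left ?_ (abs_nonneg _)
    have h3 := abs_le.1 (hτ i)
    have h4 := abs_le.1 (hτ (i + n))
    push_cast at h4
    rw [abs_le]; constructor <;> linarith [h3.1, h3.2, h4.1, h4.2]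
  have h3 := abs_le.1 h2
  rw [abs_le]; constructor <;> linarith [h1.1, h1.2, h3.1, h3.2]

/-- The next gap after `x k` is `d` if and only if `x k + d` is a point and none of the finitely
many smaller positive differences leads to a point. -/
lemma gap_eq_iff {x : ℤ → ℝ} (hx : StrictMono x) {d : ℝ} (hd : 0 < d) (k : ℤ) :
    x (k + 1) - x k = d ↔ x k ∈ ((· + d) ⁻¹' Set.range x) \
      ⋃ e ∈ {e | 0 < e ∧ e < d ∧ ∃ y ∈ Set.range x, ∃ z ∈ Set.range x, e = y - z},
        (· + e) ⁻¹' Set.range x := by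
  simp only [Set.mem_sdiff, Set.mem_preimage, Set.mem_iUnion, exists_prop, not_exists, not_and]
  constructor
  · intro h
    refine ⟨⟨k + 1, by linarith⟩, ?_⟩
    rintro e ⟨h0, h1, -⟩ ⟨j, hj⟩
    have hj1 : k < j := hx.lt_iff_lt.1 (by linarith)
    have hj2 : j < k + 1 := hx.lt_iff_lt.1 (by linarith)
    omega
  · rintro ⟨⟨j, hj⟩, hmin⟩
    have hj1 : k < j := hx.lt_iff_lt.1 (by linarith)
    rcases (Int.add_one_le_of_lt hj1).lt_or_eq with h | h
    · have h1 := hx h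
      have h2 := hx (lt_add_one k)
      exact absurd ⟨k + 1, by ring⟩ (hmin (x (k + 1) - x k)
        ⟨by linarith, by linarith, _, ⟨_, rfl⟩, _, ⟨_, rfl⟩, rfl⟩)
    · rw [h]; linarith

/-- A window with length in `ℤ + ℤε` gives a balanced word: every letter is coded by a Boolean
combination of intervals with endpoints in one coset of `ℤ + ℤε`. -/
lemma isBalanced_of_mem_ZAdd {ε η s t : ℝ} (hε : Irrational ε) (hη : Irrational η) (hδ : ε < η)
    {A : Set ℝ} (h1 : Set.Ioo s t ⊆ A) (h2 : A ⊆ Set.Icc s t) (hmem : t - s ∈ ZAdd ε)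
    {x : ℤ → ℝ} (hx : StrictMono x) (hrange : Set.range x = cutProject ε η A)
    (hfin : (Set.range fun k => x (k + 1) - x k).Finite)
    {τ C : ℝ} (hτ : ∀ n : ℤ, |x n - n * τ| ≤ C) :
    IsBalanced fun k => x (k + 1) - x k := by
  classical
  have hA : IsCosetInterval ε s A := ⟨s, t, by simpa using zero_mem_ZAdd ε, hmem, h1, h2⟩
  set F : Set (Set ℝ) := {S | ∃ B, IsCosetInterval ε s B ∧ S = cutProject ε η B} with hF
  have hinter : ∀ S ∈ F, ∀ T ∈ F, S ∩ T ∈ F := by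
    rintro _ ⟨B, hB, rfl⟩ _ ⟨B', hB', rfl⟩
    exact ⟨_, hB.inter hB', cutProject_inter hη B B'⟩
  have hfreq : ∀ S ∈ F, HasFrequency x S := by
    rintro _ ⟨B, hB, rfl⟩
    obtain ⟨κ, hκ⟩ := (hB.inter hA).exists_hasUniformDensity hε hη hδ
    rw [← cutProject_inter hη, ← hrange] at hκ
    exact hκ.hasFrequency hx hτ
  have hpre : ∀ e, (∃ y ∈ Set.range x, ∃ z ∈ Set.range x, e = y - z) →
      (· + e) ⁻¹' Set.range x ∈ F := by
    rw [hrange]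
    rintro _ ⟨_, ⟨a, b, rfl, -⟩, _, ⟨c, d, rfl, -⟩, rfl⟩
    have he : (a + b * η - (c + d * η) : ℝ) = ((a - c : ℤ) : ℝ) + (b - d : ℤ) * η := by
      push_cast; ring
    rw [he, preimage_add_cutProject]
    exact ⟨_, hA.preimage_add ⟨_, _, rfl⟩, rfl⟩
  have hletter : ∀ d ∈ Set.range fun k => x (k + 1) - x k, ∃ κ C : ℝ, ∀ (i : ℤ) (n : ℕ),
      |((factorAt (fun k => x (k + 1) - x k) i n).count d : ℝ) - κ * n| ≤ C := by
    rintro d ⟨k, hk⟩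
    dsimp only at hk
    have hd : 0 < d := by have := hx (lt_add_one k); linarith
    set E := {e | 0 < e ∧ e < d ∧ ∃ y ∈ Set.range x, ∃ z ∈ Set.range x, e = y - z} with hE
    have hEfin : E.Finite := (finite_differences hδ h2 d).subset fun e he => by
      rw [← hrange]
      exact ⟨by rw [abs_of_pos he.1]; exact he.2.1.le, he.2.2⟩
    obtain ⟨κ, C, hC⟩ := hasFrequency_diff_biUnion hinter hfreq hEfin.toFinset
      (fun e => (· + e) ⁻¹' Set.range x) (fun e he => hpre e ((hEfin.mem_toFinset.1 he).2.2))
      _ (hpre d ⟨_, ⟨_, rfl⟩, _, ⟨_, rfl⟩, hk.symm⟩)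
    refine ⟨κ, C, fun i n => ?_⟩
    convert hC i n using 3
    rw [count_factorAt]
    unfold visits
    refine Finset.sum_congr rfl fun l _ => ?_
    simp only [Set.Finite.mem_toFinset, Set.indicator_apply, ← gap_eq_iff hx hd, hE, Pi.one_apply]
  choose! κ C hC using hletter
  have hC0 : ∀ d ∈ Set.range fun k => x (k + 1) - x k, 0 ≤ C d := fun d hd =>
    (abs_nonneg _).trans (hC d hd 0 0)
  refine ⟨2 * ∑ d ∈ hfin.toFinset, C d + 1, ?_, ?_⟩
  · have := Finset.sum_nonneg fun d hd => hC0 d (hfin.mem_toFinset.1 hd)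
    linarith
  · rintro _ _ ⟨i, n, rfl⟩ ⟨j, m, rfl⟩ hlen d
    have hnm : n = m := by simpa [factorAt] using hlen
    subst hnm
    by_cases hd : d ∈ Set.range fun k => x (k + 1) - x k
    · have hle := Finset.single_le_sum (fun d hd => hC0 d (hfin.mem_toFinset.1 hd))
        (hfin.mem_toFinset.2 hd)
      have h3 := abs_le.1 (hC d hd i n)
      have h4 := abs_le.1 (hC d hd j n)
      have h5 : ((factorAt (fun k => x (k + 1) - x k) i n).count d : ℝ)
        - (factorAt (fun k => x (k + 1) - x k) j n).count d
          ≤ 2 * ∑ d ∈ hfin.toFinset, C d + 1 := by linarith [h3.2, h4.1]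
      convert h5
    · have hz : (factorAt (fun k => x (k + 1) - x k) i n).count d = 0 := by
        rw [List.count_eq_zero]
        intro hmem'
        simp only [factorAt, List.mem_ofFn] at hmem'
        obtain ⟨l, hl⟩ := hmem'
        exact hd ⟨_, hl⟩
      have h5 : ((factorAt (fun k => x (k + 1) - x k) i n).count d : ℝ)
        - (factorAt (fun k => x (k + 1) - x k) j n).count d
          ≤ 2 * ∑ d ∈ hfin.toFinset, C d + 1 := by
        rw [hz]
        have := Finset.sum_nonneg fun d hd => hC0 d (hfin.mem_toFinset.1 hd)
        have : (0 : ℝ) ≤ (factorAt (fun k => x (k + 1) - x k) j n).count d := Nat.cast_nonneg _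
        push_cast; linarith
      convert h5

/-! ### The equivalence -/

lemma exists_Ioo_subset_subset_Icc {Ω : Set ℝ} (hΩ : Ω.OrdConnected)
    (hbdd : Bornology.IsBounded Ω) (hnt : Ω.Nontrivial) :
    ∃ s t, s < t ∧ Set.Ioo s t ⊆ Ω ∧ Ω ⊆ Set.Icc s t := by
  obtain ⟨x, hx, y, hy, hxy⟩ := hnt.exists_lt
  have hb := isBounded_iff_bddBelow_bddAbove.1 hbdd
  refine ⟨sInf Ω, sSup Ω, ?_, ?_, subset_Icc_csInf_csSup hb.1 hb.2⟩
  · exact (csInf_le hb.1 hx).trans_lt (hxy.trans_le (le_csSup hb.2 hy))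
  · rintro z ⟨h1, h2⟩
    obtain ⟨a, ha, haz⟩ := exists_lt_of_csInf_lt ⟨x, hx⟩ h1
    obtain ⟨b, hb', hbz⟩ := exists_lt_of_lt_csSup ⟨x, hx⟩ h2
    exact hΩ.out ha hb' ⟨haz.le, hbz.le⟩

lemma volume_real_eq {s t : ℝ} {Ω : Set ℝ} (hst : s ≤ t) (h1 : Set.Ioo s t ⊆ Ω)
    (h2 : Ω ⊆ Set.Icc s t) : volume.real Ω = t - s := by
  refine le_antisymm ?_ ?_
  · rw [← Real.volume_real_Icc_of_le hst]
    exact measureReal_mono h2 (by simp)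
  · rw [← Real.volume_real_Ioo_of_le hst]
    exact measureReal_mono h1 (measure_ne_top_of_subset h2 (by simp))

lemma cutProject_neg_neg (ε η : ℝ) (Ω : Set ℝ) :
    cutProject (-ε) (-η) Ω = cutProject ε η Ω := by
  ext x
  constructor <;>
  · rintro ⟨a, b, rfl, hab⟩
    exact ⟨a, -b, by push_cast; ring, by simpa using hab⟩

lemma ZAdd_neg (ε : ℝ) : ZAdd (-ε) = ZAdd ε := by
  ext x
  constructor <;>
  · rintro ⟨a, b, rfl⟩
    exact ⟨a, -b, by push_cast; ring⟩

/-- The case `ε < η` of the equivalence. -/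
lemma equivalence_of_lt {ε η : ℝ} (hε : Irrational ε) (hη : Irrational η) (hδ : ε < η)
    {Ω : Set ℝ} (hΩ : Ω.OrdConnected) (hbdd : Bornology.IsBounded Ω) (hnt : Ω.Nontrivial) :
    (IsDelone (cutProject ε η Ω) ∧
      IsIncreasingEnumeration (enumeration (cutProject ε η Ω)) (cutProject ε η Ω) ∧
      (Set.range (cutProjectWord ε η Ω)).Finite) ∧
    List.TFAE [IsBDL (cutProject ε η Ω), IsBalanced (cutProjectWord ε η Ω),
      volume.real Ω ∈ ZAdd ε] ∧
    (IsBDL (cutProject ε η Ω) → BoundedDistEquiv (cutProject ε η Ω)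
      (AddSubgroup.zmultiples (|η - ε| / volume.real Ω) : Set ℝ)) := by
  obtain ⟨s, t, hst, h1, h2⟩ := exists_Ioo_subset_subset_Icc hΩ hbdd hnt
  rw [volume_real_eq hst.le h1 h2, abs_of_pos (sub_pos.2 hδ)]
  have hD := isDelone_cutProject hε hδ hst h1 h2
  have hE := isIncreasingEnumeration_cutProject hε hδ hst h1 h2
  have hF := finite_range_cutProjectWord hε hδ hst h1 h2
  refine ⟨⟨hD, hE, hF⟩, ?_⟩
  unfold cutProjectWord gapWord at *
  set x := enumeration (cutProject ε η Ω)
  obtain ⟨hx, hrange, -, -⟩ := hE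
  have hτ0 : 0 < (η - ε) / (t - s) := div_pos (sub_pos.2 hδ) (sub_pos.2 hst)
  have hkesten : (∃ κ, HasUniformDensity (cutProject ε η Ω) κ) → t - s ∈ ZAdd ε := by
    rintro ⟨κ, hκ⟩
    exact ((hκ.hasBoundedRemainder hη hδ h2).eq_length hε hst.le h1 h2).2
  have hlinear : t - s ∈ ZAdd ε → ∃ C, ∀ n : ℤ, |x n - n * ((η - ε) / (t - s))| ≤ C := by
    intro h
    have hu := (hasBoundedRemainder_of_mem_ZAdd hε hst.le h1 h2 h).hasUniformDensity hη hδ h2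
    rw [← hrange] at hu
    obtain ⟨C, hC⟩ := hu.exists_abs_sub_le hx (div_pos (sub_pos.2 hst) (sub_pos.2 hδ))
    rw [one_div_div] at hC
    exact ⟨C, hC⟩
  have hac : IsBDL (cutProject ε η Ω) → t - s ∈ ZAdd ε := fun h =>
    hkesten h.exists_hasUniformDensity
  have hce : t - s ∈ ZAdd ε → BoundedDistEquiv (cutProject ε η Ω)
      (AddSubgroup.zmultiples ((η - ε) / (t - s)) : Set ℝ) := by
    intro h
    obtain ⟨C, hC⟩ := hlinear h
    rw [← hrange] at hD ⊢
    exact boundedDistEquiv_of_abs_sub_le hx hD hτ0 hC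
  refine ⟨?_, fun h => hce (hac h)⟩
  tfae_have 1 → 3 := hac
  tfae_have 3 → 1 := fun h => (hce h).isBDL hτ0.ne'
  tfae_have 2 → 3 := fun h => hkesten (by
    rw [← hrange] at hD ⊢
    exact IsBalanced.exists_hasUniformDensity hx hD h hF)
  tfae_have 3 → 2 := fun h => by
    obtain ⟨C, hC⟩ := hlinear h
    exact isBalanced_of_mem_ZAdd hε hη hδ h1 h2 h hx hrange hF hC
  tfae_finish

end CutProject

theorem mainTheorem3 (ε η : ℝ) (hε : Irrational ε) (hη : Irrational η) (hne : ε ≠ η)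
    (Ω : Set ℝ) (hΩ : Ω.OrdConnected) (hbdd : Bornology.IsBounded Ω) (hnt : Ω.Nontrivial) :
    -- the coding word is well defined, and its alphabet is finite
    (CutProject.IsDelone (CutProject.cutProject ε η Ω) ∧
      CutProject.IsIncreasingEnumeration
        (CutProject.enumeration (CutProject.cutProject ε η Ω)) (CutProject.cutProject ε η Ω) ∧
      (Set.range (CutProject.cutProjectWord ε η Ω)).Finite) ∧
    -- the equivalence of the three statements
    List.TFAE
      [CutProject.IsBDL (CutProject.cutProject ε η Ω),
        CutProject.IsBalanced (CutProject.cutProjectWord ε η Ω),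
        volume.real Ω ∈ CutProject.ZAdd ε] ∧
    -- the lattice
    (CutProject.IsBDL (CutProject.cutProject ε η Ω) →
      CutProject.BoundedDistEquiv (CutProject.cutProject ε η Ω)
        (AddSubgroup.zmultiples (|η - ε| / volume.real Ω) : Set ℝ)) := by
  rcases hne.lt_or_gt with h | h
  · exact CutProject.equivalence_of_lt hε hη h hΩ hbdd hnt
  · have key := CutProject.equivalence_of_lt hε.neg hη.neg (neg_lt_neg h) hΩ hbdd hnt
    unfold CutProject.cutProjectWord at key ⊢
    rwa [CutProject.cutProject_neg_neg, CutProject.ZAdd_neg, neg_sub_neg, abs_sub_comm] at key
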